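/- **Setting.** Let $G$ be a locally compact, second countable (Hausdorff) group with left Haar measure $dx$ and modular function $\Delta$, let $w:G\to(0,\infty)$ be continuous with $w(xy)\le w(x)w(y)$ and $w(x^{-1})=w(x)$, and for $1\le p<\infty$ and a weight $v:G\to(0,\infty)$ let $\|f\|_{L_{p,v}}=\|vf\|_{L_p(G)}$. Let $\pi$ be a strongly continuous unitary representation of $G$ on a separable Hilbert space $\mathcal H$ and $u\in\mathcal H$ such that the voice transform $Vv(x)=\langle v,\pi(x)u\rangle$ is an isometry from $\mathcal H$ into $L_2(G)$. Put $K=Vu$ and assume $K\in L_{p,w}(G)$ for all $1<p<\infty$. Let $\mathcal S_w=\{v\in\mathcal H: Vv\in L_{p,w}(G)\ \forall\,1<p<\infty\}$ with the topology of the seminorms $\|Vv\|_{L_{p,w}}$, $1<p<\infty$, let $\mathcal S_w'$ be its anti-linear dual, and let $V_eT(x)=\langle T,\pi(x)u\rangle$ for $T\in\mathcal S_w'$. A weight $m$ is $w$-moderate if it is continuous, positive and $m(xy)\le w(x)m(y)$, $m(xy)\le m(x)w(y)$. For such $m$ and $1<r<\infty$ let $\mathrm{Co}(L_{r,m})=\{T\in\mathcal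 S_w': V_eT\in L_{r,m}(G)\}$ with norm $\|V_eT\|_{L_{r,m}}$, and $\mathcal M_{r,m}=\{f\in L_{r,m}(G): f*K=f\}$, where $(f*g)(x)=\int_G f(y)g(y^{-1}x)\,dy$ (each class is represented by the function $f*K$). Let $\mathrm{osc}^\rho_Uf(x)=\sup_{z\in U}|f(xz)-f(x)|$. **Assumption $(A_{r,m})$**, for $1<r<\infty$ and a $w$-moderate $m$: (a) $RC_K:f\mapsto f*K$ is a well-defined (hence bounded) operator on $L_{r,m}(G)$; (b) there are a unit neighborhood $U_0$ and constants $C_U\ge 0$ with $\|\mathrm{osc}^\rho_Uf\|_{L_{r,m}}\le C_U\|f\|_{L_{r,m}}$ for all $f\in\mathcal M_{r,m}$ and all unit neighborhoods $U\subset U_0$; (c) for every $\varepsilon>0$ there is a unit neighborhood $U_\varepsilon\subset U_0$ with $C_U\le\varepsilon$ for all unit neighborhoods $U\subset U_\varepsilon$. A family $X=(x_i)_{i\in I}$ in $G$ is relatively separated if for every compact unit neighborhood $Q$ the number $\sum_i\chi_{x_iQ}(x)$ is bounded uniformly in $x\in G$. A $U$-BUPU with localizing family $X$ is a family of measurable functions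 $\psi_i:G\to[0,1]$ with $\psi_i=0$ off $x_iU$ and $\sum_i\psi_i=1$, where $X$ is relatively separated. Let $\ell_{r,m_X}(I)$ be the space of all $c\in\mathbb C^I$ with finite norm $\big(\sum_i (m(x_i)|c_i|)^r\big)^{1/r}$. **Theorem.** (i) Let $(A_{r,m})$ hold, let $U\subset U_0^{-1}$ be a compact unit neighborhood with $\|RC_K\|_{L_{r,m}\to L_{r,m}}\cdot C_{U^{-1}}<1$, and let $X=(x_i)_{i\in I}$ be a relatively separated family in $G$ admitting a $U$-BUPU $\Psi=(\psi_i)_{i\in I}$ with localizing family $X$. Then $(\pi(x_i)u)_{i\in I}$ is a Banach frame for $\mathrm{Co}(L_{r,m})$ with coefficient space $\ell_{r,m_X}(I)$: each $T\mapsto\langle T,\pi(x_i)u\rangle$ is a bounded functional on $\mathrm{Co}(L_{r,m})$; the sampling operator $\mathrm{Samp}:\mathrm{Co}(L_{r,m})\to\ell_{r,m_X}(I)$, $T\mapsto(\langle T,\pi(x_i)u\rangle)_{i\in I}$, is well-defined, bounded and bounded below; and there is a bounded linear operator $R_{\mathrm{Co}}:\ell_{r,m_X}(I)\to\mathrm{Co}(L_{r,m})$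 with $R_{\mathrm{Co}}\circ\mathrm{Samp}=\mathrm{id}$. (ii) The operators $R_{\mathrm{Co}}$ can be chosen so that, for fixed $X$ and $\Psi$, their action does not depend on $(r,m)$ (nor on $U$, $U_0$ and the constants $C_U$): if the hypotheses of (i) hold for $(r_1,m_1)$ and for $(r_2,m_2)$, then the corresponding operators satisfy $R_1c=R_2c$ for all $c\in\ell_{r_1,m_{1,X}}(I)\cap\ell_{r_2,m_{2,X}}(I)$. (iii) Let $1<r<\infty$, let $m$ be $w$-moderate and let $RC_K$ be well-defined on $L_{r,m}(G)$. Suppose there is a continuous $W:G\to\mathbb C$ with $K*W=K$ such that, for some compact unit neighborhood $Q$, the local maximal function $x\mapsto\|W\|_{L_\infty(xQ)}$ lies in $L_{1,w}(G)\cap L_{1,w\Delta^{-1}}(G)$. Then $(A_{r,m})$ holds. -/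

import Mathlib

open MeasureTheory Filter Topology
open scoped ENNReal NNReal Pointwise

noncomputable section

namespace Coorbit

section Functions

variable {G : Type*} [Group G] [MeasurableSpace G]

/-- `f ∈ L_{p,v}(G)`: the function `v f` is `p`-integrable. -/
def MemLw (μ : Measure G) (v : G → ℝ) (p : ℝ) (f : G → ℂ) : Prop :=
  MemLp (fun x => (v x : ℂ) * f x) (ENNReal.ofReal p) μ

/-- The norm of `f` in `L_{p,v}(G)`, as an extended nonnegative number. -/
def normLw (μ : Measure G) (v : G → ℝ) (p : ℝ) (f : G → ℂ) : ℝ≥0∞ :=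
  eLpNorm (fun x => (v x : ℂ) * f x) (ENNReal.ofReal p) μ

/-- The convolution `(f * g)(x) = ∫ f(y) g(y⁻¹ x) dy`. -/
def conv (μ : Measure G) (f g : G → ℂ) (x : G) : ℂ :=
  ∫ y, f y * g (y⁻¹ * x) ∂μ

/-- `f` and `g` are convolvable: the integrand of the convolution is integrable for a.e. `x`. -/
def Convolvable (μ : Measure G) (f g : G → ℂ) : Prop :=
  ∀ᵐ x ∂μ, Integrable (fun y => f y * g (y⁻¹ * x)) μ

/-- The right oscillation `sup_{u ∈ U} |f(xu) - f(x)|`, with values in `[0,∞]`. -/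
def oscRight (U : Set G) (f : G → ℂ) (x : G) : ℝ≥0∞ :=
  ⨆ u ∈ U, ‖f (x * u) - f x‖ₑ

/-- The `L_{p,v}` norm of a `[0,∞]`-valued function. -/
def normLwENN (μ : Measure G) (v : G → ℝ) (p : ℝ) (F : G → ℝ≥0∞) : ℝ≥0∞ :=
  eLpNorm (fun x => ENNReal.ofReal (v x) * F x) (ENNReal.ofReal p) μ

/-- The local maximal function `x ↦ ‖W‖_{L_∞(xU)}`. -/
def localMax (μ : Measure G) (U : Set G) (W : G → ℂ) (x : G) : ℝ≥0∞ :=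
  eLpNorm W ∞ (μ.restrict (x • U))

/-- Right convolution with `K` is a well-defined map of `L_{r,m}(G)` into itself. -/
def RightConvWellDefined (μ : Measure G) (m : G → ℝ) (r : ℝ) (K : G → ℂ) : Prop :=
  ∀ f : G → ℂ, MemLw μ m r f → Convolvable μ f K ∧ MemLw μ m r (conv μ f K)

/-- The operator norm of right convolution with `K` on `L_{r,m}(G)`, with values in `[0,∞]`. -/
def rightConvNorm (μ : Measure G) (m : G → ℝ) (r : ℝ) (K : G → ℂ) : ℝ≥0∞ :=
  ⨆ (f : G → ℂ) (_ : MemLw μ m r f ∧ normLw μ m r f ≤ 1), normLw μ m r (conv μ f K)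

/-- The reproducing kernel space of all `f ∈ L_{r,m}(G)` with `f * K = f`. The equation is required
at every point: this selects the representative `f * K` of each class. -/
def MemRKS (μ : Measure G) (m : G → ℝ) (r : ℝ) (K : G → ℂ) (f : G → ℂ) : Prop :=
  MemLw μ m r f ∧ ∀ x, conv μ f K x = f x

variable [TopologicalSpace G]

/-- The modular function `Δ`, normalised by `μ(E x) = Δ(x) μ(E)` for a left Haar measure `μ`
(Mathlib's `modularCharacter` satisfies `μ(E x⁻¹) = modularCharacter x • μ(E)`). -/
def modularFunction [IsTopologicalGroup G] [LocallyCompactSpace G] (x : G) : ℝ :=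
  ((Measure.modularCharacter x : ℝ≥0) : ℝ)⁻¹

/-- A control weight: continuous, positive, submultiplicative and symmetric. -/
structure IsControlWeight (w : G → ℝ) : Prop where
  continuous : Continuous w
  pos : ∀ x, 0 < w x
  submul : ∀ x y, w (x * y) ≤ w x * w y
  symm : ∀ x, w x⁻¹ = w x

/-- A `w`-moderate weight. -/
structure IsModerate (w m : G → ℝ) : Prop where
  continuous : Continuous m
  pos : ∀ x, 0 < m x
  left : ∀ x y, m (x * y) ≤ w x * m y
  right : ∀ x y, m (x * y) ≤ m x * w y

/-- A family is relatively separated if for every compact unit neighborhood `Q` the number of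
indices `i` with `x ∈ x_i Q` is bounded uniformly in `x`. -/
def RelativelySeparated {I : Type*} (X : I → G) : Prop :=
  ∀ Q : Set G, IsCompact Q → Q ∈ 𝓝 (1 : G) →
    ∃ N : ℕ, ∀ x : G, {i | x ∈ X i • Q}.encard ≤ N

/-- `ψ` is a `U`-BUPU (bounded uniform partition of unity) with localizing family `X`. -/
structure IsBUPU {I : Type*} (U : Set G) (X : I → G) (ψ : I → G → ℝ) : Prop where
  measurable : ∀ i, Measurable (ψ i)
  mem_Icc : ∀ i x, ψ i x ∈ Set.Icc (0 : ℝ) 1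
  separated : RelativelySeparated X
  support : ∀ i x, x ∉ X i • U → ψ i x = 0
  sum_eq_one : ∀ x, HasSum (fun i => ψ i x) 1

end Functions

section SequenceSpaces

variable {I : Type*}

/-- The weighted sequence space `ℓ_{r,v}(I)`. -/
def seqSpace (v : I → ℝ) (r : ℝ) : Submodule ℂ (I → ℂ) where
  carrier := {c | Memℓp (fun i => (v i : ℂ) * c i) (ENNReal.ofReal r)}
  zero_mem' := by
    have : (fun i => (v i : ℂ) * (0 : I → ℂ) i) = 0 := by ext i; simp
    change Memℓp _ _
    rw [this]; exact zero_memℓp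
  add_mem' := by
    intro a b ha hb
    have : (fun i => (v i : ℂ) * (a + b) i)
        = (fun i => (v i : ℂ) * a i) + (fun i => (v i : ℂ) * b i) := by
      ext i; simp [mul_add]
    change Memℓp _ _
    rw [this]; exact Memℓp.add ha hb
  smul_mem' := by
    intro a b hb
    have : (fun i => (v i : ℂ) * (a • b) i) = a • (fun i => (v i : ℂ) * b i) := by
      ext i; simp; ring
    change Memℓp _ _
    rw [this]; exact Memℓp.const_smul hb a

/-- The norm `(∑ |v_i c_i|^r)^{1/r}` of `ℓ_{r,v}(I)`. -/
def seqNorm (v : I → ℝ) (r : ℝ) (c : I → ℂ) : ℝ :=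
  (∑' i, (v i * ‖c i‖) ^ r) ^ (1 / r)

end SequenceSpaces

variable {G : Type*} [TopologicalSpace G] [Group G] [MeasurableSpace G]
  {H : Type*} [NormedAddCommGroup H] [InnerProductSpace ℂ H]

/-- The standing data: a control weight `w` on `G` and a strongly continuous unitary representation
`π` of `G` on `H` that is reproducing for the vector `u`, such that the reproducing kernel
`K(x) = ⟨u, π(x)u⟩` lies in `L_{p,w}(G)` for all `1 < p < ∞`. (Mathlib's inner product is linear
in its second argument.) -/
structure Setting (μ : Measure G) (H : Type*) [NormedAddCommGroup H] [InnerProductSpace ℂ H] where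
  w : G → ℝ
  isControlWeight : IsControlWeight w
  π : G →* (H ≃ₗᵢ[ℂ] H)
  π_continuous : ∀ v : H, Continuous fun x => π x v
  u : H
  /-- The voice transform maps into `L_2(G)`. -/
  voice_memLp : ∀ v : H, MemLp (fun x => inner ℂ (π x u) v) 2 μ
  /-- The voice transform is an isometry into `L_2(G)`. -/
  voice_isometry : ∀ v : H, eLpNorm (fun x => inner ℂ (π x u) v) 2 μ = ‖v‖ₑ
  kernel_mem : ∀ p : ℝ, 1 < p → MemLw μ w p fun x => inner ℂ (π x u) u

namespace Setting

variable {μ : Measure G} (S : Setting μ H)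

/-- The voice transform `(Vv)(x) = ⟨v, π(x)u⟩`. -/
def voice (v : H) (x : G) : ℂ := inner ℂ (S.π x S.u) v

/-- The reproducing kernel `K = Vu`. -/
def K : G → ℂ := S.voice S.u

lemma voice_add (v v' : H) : S.voice (v + v') = S.voice v + S.voice v' := by
  ext x; simp [voice]

lemma voice_smul (c : ℂ) (v : H) : S.voice (c • v) = c • S.voice v := by
  ext x; simp [voice]

lemma weighted_voice_add (a : G → ℝ) (v v' : H) :
    (fun x => (a x : ℂ) * S.voice (v + v') x)
      = (fun x => (a x : ℂ) * S.voice v x) + (fun x => (a x : ℂ) * S.voice v' x) := by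
  ext x; simp [voice_add, mul_add]

lemma weighted_voice_smul (a : G → ℝ) (c : ℂ) (v : H) :
    (fun x => (a x : ℂ) * S.voice (c • v) x) = c • (fun x => (a x : ℂ) * S.voice v x) := by
  ext x; simp [voice_smul]; ring

/-- The test space `𝓢_w` of all `v` with `Vv ∈ L_{p,w}(G)` for all `1 < p < ∞`, as a subspace. -/
def testSubmodule : Submodule ℂ H where
  carrier := {v | ∀ p : ℝ, 1 < p → MemLw μ S.w p (S.voice v)}
  zero_mem' := by
    intro p _
    have : (fun x => (S.w x : ℂ) * S.voice 0 x) = 0 := by ext x; simp [voice]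
    unfold MemLw
    rw [this]; exact MemLp.zero
  add_mem' := by
    intro v v' hv hv' p hp
    unfold MemLw
    rw [weighted_voice_add]; exact (hv p hp).add (hv' p hp)
  smul_mem' := by
    intro c v hv p hp
    unfold MemLw
    rw [weighted_voice_smul]; exact (hv p hp).const_smul c

/-- The test space `𝓢_w`, a type of its own because its topology is not the one inherited
from `H`. -/
def TestSpace : Type _ := S.testSubmodule

instance : AddCommGroup S.TestSpace := inferInstanceAs (AddCommGroup S.testSubmodule)

instance : Module ℂ S.TestSpace := inferInstanceAs (Module ℂ S.testSubmodule)

/-- The seminorms `v ↦ ‖Vv‖_{L_{p,w}}` for `1 < p < ∞`. -/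
def testSeminorm : SeminormFamily ℂ S.TestSpace {p : ℝ // 1 < p} := fun p =>
  Seminorm.of (fun v : S.TestSpace => (normLw μ S.w p.1 (S.voice v.1)).toReal)
    (by
      intro v v'
      have hp : (1 : ℝ≥0∞) ≤ ENNReal.ofReal p.1 := by
        simpa using ENNReal.ofReal_le_ofReal p.2.le
      have h := v.2 p.1 p.2
      have h' := v'.2 p.1 p.2
      have e : normLw μ S.w p.1 (S.voice (v + v').1)
          ≤ normLw μ S.w p.1 (S.voice v.1) + normLw μ S.w p.1 (S.voice v'.1) := by
        have : (v + v').1 = v.1 + v'.1 := rfl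
        unfold normLw
        rw [this, weighted_voice_add]
        exact eLpNorm_add_le h.1 h'.1 hp
      have t1 : normLw μ S.w p.1 (S.voice v.1) ≠ ∞ := h.2.ne
      have t2 : normLw μ S.w p.1 (S.voice v'.1) ≠ ∞ := h'.2.ne
      rw [← ENNReal.toReal_add t1 t2]
      exact ENNReal.toReal_mono (ENNReal.add_ne_top.2 ⟨t1, t2⟩) e)
    (by
      intro c v
      have : (c • v).1 = c • v.1 := rfl
      unfold normLw
      rw [this, weighted_voice_smul, eLpNorm_const_smul, ENNReal.toReal_mul, toReal_enorm])

instance : Nonempty {p : ℝ // 1 < p} := ⟨⟨2, by norm_num⟩⟩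

/-- The locally convex topology of `𝓢_w` given by the seminorms `‖Vv‖_{L_{p,w}}`. -/
instance : TopologicalSpace S.TestSpace := S.testSeminorm.moduleFilterBasis.topology

lemma testSpace_withSeminorms : WithSeminorms S.testSeminorm := ⟨rfl⟩

/-- The space of distributions: the anti-linear dual `𝓢_w'` of all continuous anti-linear
functionals on the test space. -/
abbrev Distribution : Type _ := S.TestSpace →L⋆[ℂ] ℂ

lemma voice_continuous (v : H) : Continuous (S.voice v) :=
  (S.π_continuous S.u).inner continuous_const

lemma voice_pi (x y : G) : S.voice (S.π x S.u) y = S.K (x⁻¹ * y) := by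
  have : S.π x (S.π (x⁻¹ * y) S.u) = S.π y S.u := by
    simp
  simp only [K, voice]
  rw [← this, LinearIsometryEquiv.inner_map_map]

variable [IsTopologicalGroup G] [BorelSpace G] [μ.IsHaarMeasure]

/-- The orbit of `u` stays in the test space. -/
lemma pi_u_mem (x : G) : S.π x S.u ∈ S.testSubmodule := by
  intro p hp
  have h1 : MemLp (fun y => (S.w (x⁻¹ * y) : ℂ) * S.K (x⁻¹ * y)) (ENNReal.ofReal p) μ :=
    (S.kernel_mem p hp).comp_measurePreserving (measurePreserving_mul_left μ x⁻¹)
  refine h1.of_le_mul (c := S.w x) ?_ (Eventually.of_forall fun y => ?_)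
  · exact ((Complex.continuous_ofReal.comp S.isControlWeight.continuous).mul
      (S.voice_continuous _)).aestronglyMeasurable
  · have hw : S.w y ≤ S.w x * S.w (x⁻¹ * y) := by
      simpa using S.isControlWeight.submul x (x⁻¹ * y)
    have p1 := (S.isControlWeight.pos y).le
    have p2 := (S.isControlWeight.pos (x⁻¹ * y)).le
    rw [voice_pi, norm_mul, norm_mul, Complex.norm_of_nonneg p1, Complex.norm_of_nonneg p2,
      ← mul_assoc]
    exact mul_le_mul_of_nonneg_right hw (norm_nonneg _)

/-- The vector `π(x)u` as an element of the test space. -/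
def orbit (x : G) : S.TestSpace := ⟨S.π x S.u, S.pi_u_mem x⟩

/-- The extended voice transform `(V_e T)(x) = ⟨T, π(x)u⟩`. -/
def extVoice (T : S.Distribution) (x : G) : ℂ := T (S.orbit x)

/-- The coorbit space of `L_{r,m}(G)`: all distributions `T` with `V_e T ∈ L_{r,m}(G)`. -/
def Co (r : ℝ) (m : G → ℝ) : Submodule ℂ S.Distribution where
  carrier := {T | MemLw μ m r (S.extVoice T)}
  zero_mem' := by
    have : (fun x => (m x : ℂ) * S.extVoice 0 x) = 0 := by ext x; simp [extVoice]
    change MemLp _ _ _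
    rw [this]; exact MemLp.zero
  add_mem' := by
    intro T T' hT hT'
    have : (fun x => (m x : ℂ) * S.extVoice (T + T') x)
        = (fun x => (m x : ℂ) * S.extVoice T x) + (fun x => (m x : ℂ) * S.extVoice T' x) := by
      ext x; simp [extVoice, mul_add]
    change MemLp _ _ _
    rw [this]; exact MemLp.add hT hT'
  smul_mem' := by
    intro c T hT
    have : (fun x => (m x : ℂ) * S.extVoice (c • T) x)
        = c • (fun x => (m x : ℂ) * S.extVoice T x) := by
      ext x; simp [extVoice]; ring
    change MemLp _ _ _
    rw [this]; exact MemLp.const_smul hT c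

/-- The coorbit norm `‖T‖ = ‖V_e T‖_{L_{r,m}}`. -/
def coNorm (r : ℝ) (m : G → ℝ) (T : S.Distribution) : ℝ :=
  (normLw μ m r (S.extVoice T)).toReal

/-- The kernel assumption for the pair `(r, m)`, with a unit neighborhood `U₀` and constants
`C U`. (That `K ∈ L_{p,w}(G)` for `1 < p < ∞` is part of the setting.) -/
structure KernelAssumption (r : ℝ) (m : G → ℝ) (U₀ : Set G) (C : Set G → ℝ≥0) : Prop where
  one_lt : 1 < r
  moderate : IsModerate S.w m
  rightConv : RightConvWellDefined μ m r S.K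
  nhds : U₀ ∈ 𝓝 (1 : G)
  osc_le : ∀ U ∈ 𝓝 (1 : G), U ⊆ U₀ → ∀ f : G → ℂ, MemRKS μ m r S.K f →
    normLwENN μ m r (oscRight U f) ≤ C U * normLw μ m r f
  const_small : ∀ ε : ℝ≥0, 0 < ε → ∃ Uε ∈ 𝓝 (1 : G), Uε ⊆ U₀ ∧
    ∀ U ∈ 𝓝 (1 : G), U ⊆ Uε → C U ≤ ε

/-- The density condition on the compact unit neighborhood `U`. -/
structure DensityCondition (r : ℝ) (m : G → ℝ) (U₀ : Set G) (C : Set G → ℝ≥0)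
    (U : Set G) : Prop where
  compact : IsCompact U
  nhds : U ∈ 𝓝 (1 : G)
  subset : U ⊆ U₀⁻¹
  lt_one : rightConvNorm μ m r S.K * C U⁻¹ < 1

variable {I : Type*}

/-- The sampling map `T ↦ (⟨T, π(x_i)u⟩)_i`. -/
def samp (X : I → G) (T : S.Distribution) : I → ℂ := fun i => S.extVoice T (X i)

/-- The family `(π(x_i)u)_i` is a Banach frame for `Co(L_{r,m})` with coefficient space
`ℓ_{r,m_X}(I)`, where `(m_X)_i = m(x_i)`, and with reconstruction operator `R`. -/
structure IsBanachFrame (r : ℝ) (m : G → ℝ) (X : I → G)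
    (R : seqSpace (m ∘ X) r →ₗ[ℂ] S.Co r m) : Prop where
  /-- Every `π(x_i)u` defines a bounded functional on the coorbit space. -/
  functional_bounded : ∀ i, ∃ b : ℝ, ∀ T ∈ S.Co r m, ‖S.extVoice T (X i)‖ ≤ b * S.coNorm r m T
  /-- The sampling operator is well-defined. -/
  samp_mem : ∀ T ∈ S.Co r m, S.samp X T ∈ seqSpace (m ∘ X) r
  /-- The sampling operator is bounded. -/
  samp_bounded : ∃ b : ℝ, ∀ T ∈ S.Co r m, seqNorm (m ∘ X) r (S.samp X T) ≤ b * S.coNorm r m T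
  /-- The sampling operator is bounded from below. -/
  samp_lower : ∃ a : ℝ, 0 < a ∧
    ∀ T ∈ S.Co r m, a * S.coNorm r m T ≤ seqNorm (m ∘ X) r (S.samp X T)
  /-- The reconstruction operator is bounded. -/
  rec_bounded : ∃ b : ℝ, ∀ c : seqSpace (m ∘ X) r,
    S.coNorm r m (R c : S.Distribution) ≤ b * seqNorm (m ∘ X) r (c : I → ℂ)
  /-- The reconstruction operator inverts the sampling operator from the left. -/
  rec_samp : ∀ (T : S.Distribution) (hT : T ∈ S.Co r m),
    R ⟨S.samp X T, samp_mem T hT⟩ = ⟨T, hT⟩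

/-- `W` is a well-behaved kernel for `K`: it is continuous, `K * W = K`, and for some compact unit
neighborhood its local maximal function lies in `L_{1,w}(G) ∩ L_{1,wΔ⁻¹}(G)`. -/
structure IsGoodKernel [LocallyCompactSpace G] (W : G → ℂ) : Prop where
  continuous : Continuous W
  convolvable : Convolvable μ S.K W
  conv_eq : conv μ S.K W =ᵐ[μ] S.K
  localMax_integrable : ∃ U : Set G, IsCompact U ∧ U ∈ 𝓝 (1 : G) ∧
    ∫⁻ x, ENNReal.ofReal (S.w x) * localMax μ U W x ∂μ < ∞ ∧
    ∫⁻ x, ENNReal.ofReal (S.w x * (modularFunction x)⁻¹) * localMax μ U W x ∂μ < ∞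

end Setting

end Coorbit

end

set_option linter.unusedSectionVars false

/-! Frames. On the reproducing space $\mathcal M_{r,m}$ a function is almost determined by its
samples: $\sum_i f(x_i)\psi_i$ differs from $f$ by at most the oscillation of $f$ over $U^{-1}$.
Since $f=f*K$, the error $Ef=f-(\sum_i f(x_i)\psi_i)*K$ equals $(f-\sum_i f(x_i)\psi_i)*K$ and has
norm at most $\|RC_K\|\,C_{U^{-1}}\|f\|$, so $E$ is a contraction (`normLw_residual_le`). Hence
$f=\sum_k E^k\big((\sum_i f(x_i)\psi_i)*K\big)$, and putting arbitrary coefficients $c_i$ in place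
of the samples gives the reconstruction operator (`exists_limit`, `isReconstruction_samp`).
Boundedness of sampling and of synthesis is `IsBUPU.exists_seqSum_le` and
`IsBUPU.exists_normLw_synth_le`.

Distributions. To pass between $\mathrm{Co}(L_{r,m})$ and $\mathcal M_{r,m}$ one must know which
functions are extended voice transforms, although $K$ need not be integrable. On voice transforms a
small exponent dominates a larger one (`normLw_voice_le`), so a distribution is bounded by one
seminorm with exponent $1<q<2$. Hahn-Banach and $L_q$ duality give a density $\Phi\in L_{a,1/w}$, so
$V_eT=\Phi*K$ (`exists_density_distribution`). A trilinear Young inequality justifies Fubini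
(`integral_conv_K_mul`); hence $V_eT$ is reproduced by $K$ at every point and determines $T$.
Conversely $f*K$ is a voice transform for each $f\in L_{a,1/w}$ (`exists_distribution`), and every
$L_{r,m}$ embeds into $L_{r,1/w}$.

Independence of $(r,m)$. The Neumann partial sums involve only $X$, $\psi$ and $K$. Point
evaluations are bounded on $\mathcal M_{r,m}$, so the series converges pointwise, and the pointwise
limit determines the distribution. One operator `reconstruct` therefore serves all pairs.

Good kernels. From $K*W=K$ follows $f=f*W$ on $\mathcal M_{r,m}$, hence
$\mathrm{osc}_Uf\le|f|*\mathrm{osc}_UW$. Young's inequality for $L_r*L_1$ bounds the norm by the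
$w$-weighted masses of $\mathrm{osc}_UW$ and of its reflection; the weight $w\Delta^{-1}$ enters
through the reflection. Both masses tend to $0$ as $U$ shrinks, by dominated convergence
(`exists_oscMass_le`). -/

namespace Coorbit

/-! ### Duality of $L_q$ for $1<q<2$ -/

section LpDuality

variable {α : Type*} [MeasurableSpace α] {μ : Measure α}

lemma tendsto_eLpNorm_sub_indicator {p : ℝ≥0∞} (hp0 : p ≠ 0) (hp : p ≠ ∞) {f : α → ℂ}
    (hf : MemLp f p μ) {B : ℕ → Set α} (hB : ∀ n, MeasurableSet (B n))
    (hBx : ∀ x, ∀ᶠ n in atTop, x ∈ B n) :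
    Tendsto (fun n => eLpNorm ((B n).indicator f - f) p μ) atTop (𝓝 0) := by
  have hp' : 0 < p.toReal := ENNReal.toReal_pos hp0 hp
  have key : Tendsto (fun n => ∫⁻ x, ‖((B n).indicator f - f) x‖ₑ ^ p.toReal ∂μ) atTop
      (𝓝 (∫⁻ _, 0 ∂μ)) := by
    refine tendsto_lintegral_of_dominated_convergence' (fun x => ‖f x‖ₑ ^ p.toReal) ?_ ?_ ?_ ?_
    · intro n
      exact (((hf.1.indicator (hB n)).sub hf.1).enorm).pow_const _
    · intro n
      refine Eventually.of_forall fun x => ENNReal.rpow_le_rpow ?_ hp'.le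
      by_cases hx : x ∈ B n <;> simp [hx]
    · have := hf.eLpNorm_lt_top
      rw [eLpNorm_eq_lintegral_rpow_enorm_toReal hp0 hp] at this
      intro h
      rw [h, ENNReal.top_rpow_of_pos (by positivity)] at this
      exact lt_irrefl _ this
    · refine Eventually.of_forall fun x => ?_
      refine tendsto_const_nhds.congr' ?_
      filter_upwards [hBx x] with n hn
      simp [hn, hp']
  have := (key.ennrpow_const (1 / p.toReal))
  simp only [lintegral_zero] at this
  rw [ENNReal.zero_rpow_of_pos (by positivity)] at this
  refine this.congr fun n => ?_
  rw [eLpNorm_eq_lintegral_rpow_enorm_toReal hp0 hp]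

lemma memLp_of_indicator_bounded {p : ℝ≥0∞} {f : α → ℂ} (hf : AEStronglyMeasurable f μ)
    {A : Set α} (hA : MeasurableSet A) (hμ : μ A ≠ ∞) (C : ℝ) (hC : ∀ x ∈ A, ‖f x‖ ≤ C) :
    MemLp (A.indicator f) p μ := by
  rw [memLp_indicator_iff_restrict hA]
  have : IsFiniteMeasure (μ.restrict A) := ⟨by simpa using hμ.lt_top⟩
  refine MemLp.of_bound hf.restrict C ?_
  filter_upwards [ae_restrict_mem hA] with x hx using hC x hx

/-- A strictly positive function in `L^t` on a `σ`-finite space. -/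
lemma exists_pos_memLp (μ : Measure α) [SigmaFinite μ] {t : ℝ} (ht : 0 < t) :
    ∃ h : α → ℝ, Measurable h ∧ (∀ x, 0 < h x) ∧
      MemLp (fun x => (h x : ℂ)) (ENNReal.ofReal t) μ := by
  obtain ⟨g, g0, gm, gi⟩ := exists_pos_lintegral_lt_of_sigmaFinite μ (one_ne_zero (α := ℝ≥0∞))
  refine ⟨fun x => (g x : ℝ) ^ (1 / t), by fun_prop, fun x => by have := g0 x; positivity, ?_, ?_⟩
  · exact (Complex.measurable_ofReal.comp (by fun_prop)).aestronglyMeasurable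
  · have ht0 : ENNReal.ofReal t ≠ 0 := by simpa using ht
    rw [eLpNorm_lt_top_iff_lintegral_rpow_enorm_lt_top ht0 ENNReal.ofReal_ne_top,
      ENNReal.toReal_ofReal ht.le]
    refine lt_of_le_of_lt (le_of_eq ?_) (gi.trans ENNReal.one_lt_top)
    refine lintegral_congr fun x => ?_
    have e : ‖(((g x : ℝ) ^ (1 / t) : ℝ) : ℂ)‖ₑ = (g x : ℝ≥0∞) ^ (1 / t) := by
      rw [← ofReal_norm, Complex.norm_of_nonneg (by positivity),
        ← ENNReal.ofReal_rpow_of_nonneg (by positivity) (by positivity)]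
      simp
    rw [e, ← ENNReal.rpow_mul, one_div, inv_mul_cancel₀ ht.ne', ENNReal.rpow_one]

/-- Representation of a bounded functional on `L^q`, `1 < q < 2`, against all `f ∈ L^q` which are
square integrable after division by a suitable positive function. -/
lemma exists_repr_of_div_memLp [SigmaFinite μ] {q : ℝ} (hq : 1 < q) (hq2 : q < 2)
    [Fact (1 ≤ ENNReal.ofReal q)] (Λ : Lp ℂ (ENNReal.ofReal q) μ →L[ℂ] ℂ) :
    ∃ (h : α → ℝ) (Φ : α → ℂ), Measurable h ∧ (∀ x, 0 < h x) ∧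
      (∀ n : ℕ, μ {x | 1 ≤ n * h x} ≠ ∞) ∧ Measurable Φ ∧
      ∀ (f : α → ℂ) (hf : MemLp f (ENNReal.ofReal q) μ), MemLp (fun x => f x / h x) 2 μ →
        Λ hf.toLp = ∫ x, Φ x * f x ∂μ := by
  -- Chosen so that $1/t+1/2=1/q$: multiplication by $h\in L^t$ then maps $L^2$ into $L^q$, and the
  -- functional can be pulled back to a Hilbert space.
  set t : ℝ := (1 / q - 1 / 2)⁻¹ with ht
  have ht0 : 0 < t := by
    have : 1 / 2 < 1 / q := one_div_lt_one_div_of_lt (by linarith) hq2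
    rw [ht]; exact inv_pos.2 (by linarith)
  obtain ⟨h, hm, h0, hL⟩ := exists_pos_memLp μ ht0
  have htr : ENNReal.HolderTriple (ENNReal.ofReal t) 2 (ENNReal.ofReal q) := by
    constructor
    have e2 : (2 : ℝ≥0∞) = ENNReal.ofReal 2 := by simp
    rw [e2, ← ENNReal.ofReal_inv_of_pos ht0, ← ENNReal.ofReal_inv_of_pos two_pos,
      ← ENNReal.ofReal_inv_of_pos (by linarith), ← ENNReal.ofReal_add (by positivity) (by positivity)]
    congr 1
    rw [ht, inv_inv]; ring
  have hle : Fact (1 ≤ ENNReal.ofReal t) := by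
    constructor
    rw [ENNReal.one_le_ofReal, ht]
    apply (one_le_inv₀ (inv_pos.1 ht0)).2
    have : 1 / q ≤ 1 := by rw [div_le_one (by linarith)]; exact hq.le
    linarith
  let J := (ContinuousLinearMap.mul ℂ ℂ).holderL μ (ENNReal.ofReal t) 2 (ENNReal.ofReal q) hL.toLp
  -- Riesz representation in $L^2$; dividing by $h$ afterwards undoes the multiplication.
  let g : Lp ℂ 2 μ := (InnerProductSpace.toDual ℂ (Lp ℂ 2 μ)).symm (Λ ∘L J)
  have hg : ∀ s : Lp ℂ 2 μ, Λ (J s) = inner ℂ g s := fun s => by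
    simp [g]
  refine ⟨h, fun x => starRingEnd ℂ (g x) / h x, hm, h0, ?_, ?_, ?_⟩
  · intro n
    rcases Nat.eq_zero_or_pos n with rfl | hn
    · have : {x : α | (1 : ℝ) ≤ (0 : ℕ) * h x} = ∅ := by
        ext x; simp
      rw [this]; simp
    have hn' : (0 : ℝ) < n := by exact_mod_cast hn
    have := hL.meas_ge_lt_top' (by simpa using ht0) ENNReal.ofReal_ne_top
      (ε := ENNReal.ofReal (1 / n)) (by simpa using hn.ne')
    refine ne_of_lt (lt_of_le_of_lt (measure_mono fun x hx => ?_) this)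
    change ENNReal.ofReal (1 / n) ≤ ‖(h x : ℂ)‖ₑ
    rw [← ofReal_norm, Complex.norm_of_nonneg (h0 x).le]
    apply ENNReal.ofReal_le_ofReal
    replace hx : 1 ≤ n * h x := hx
    rw [div_le_iff₀ hn']; linarith
  · exact (Complex.continuous_conj.measurable.comp (Lp.stronglyMeasurable g).measurable).div
      (Complex.measurable_ofReal.comp hm)
  · intro f hf hfh
    have e1 : J hfh.toLp = hf.toLp := by
      apply Lp.ext
      refine (ContinuousLinearMap.coeFn_holder _ _ _).trans ?_
      filter_upwards [hL.coeFn_toLp, hfh.coeFn_toLp, hf.coeFn_toLp] with x h1 h2 h3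
      have : (h x : ℂ) ≠ 0 := by exact_mod_cast (h0 x).ne'
      rw [h1, h2, h3]
      simp only [ContinuousLinearMap.mul_apply']
      field_simp
    rw [← e1, hg, L2.inner_def]
    refine integral_congr_ae ?_
    filter_upwards [hfh.coeFn_toLp] with x h2
    rw [h2]
    simp only [RCLike.inner_apply]
    ring

/-- Bounded functionals on `L^q`, `1 < q < 2`, are integrals against functions in the dual
Lebesgue space. -/
theorem exists_dual_representation [SigmaFinite μ] {q q' : ℝ} (hqq : q.HolderConjugate q')
    (hq2 : q < 2) [Fact (1 ≤ ENNReal.ofReal q)] (Λ : Lp ℂ (ENNReal.ofReal q) μ →L[ℂ] ℂ) :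
    ∃ Φ : α → ℂ, MemLp Φ (ENNReal.ofReal q') μ ∧
      ∀ (f : α → ℂ) (hf : MemLp f (ENNReal.ofReal q) μ), Λ hf.toLp = ∫ x, Φ x * f x ∂μ := by
  have hq : 1 < q := hqq.lt
  have hq' : 1 < q' := hqq.symm.lt
  have q0 : 0 < q := hqq.pos
  have q'0 : 0 < q' := hqq.symm.pos
  have hqe0 : ENNReal.ofReal q ≠ 0 := by simpa using q0
  have hqe'0 : ENNReal.ofReal q' ≠ 0 := by simpa using q'0
  obtain ⟨h, Φ, hm, h0, hfin, Φm, hrep⟩ := exists_repr_of_div_memLp hq hq2 Λ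
  -- Truncating to a set where $F$ is bounded and $h$ is bounded below produces functions to which
  -- the representation applies.
  have hdiv : ∀ (F : α → ℂ) (B : Set α) (n : ℕ) (C : ℝ), AEStronglyMeasurable F μ →
      MeasurableSet B → (∀ x ∈ B, 1 ≤ n * h x) → (∀ x ∈ B, ‖F x‖ ≤ C) → 
      MemLp (B.indicator F) (ENNReal.ofReal q) μ ∧
      MemLp (fun x => B.indicator F x / h x) 2 μ := by
    intro F B n C hF hB hBn hBC
    have hBμ : μ B ≠ ∞ :=
      ne_of_lt (lt_of_le_of_lt (measure_mono fun x hx => hBn x hx) (hfin n).lt_top)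
    refine ⟨memLp_of_indicator_bounded hF hB hBμ C hBC, ?_⟩
    have : (fun x => B.indicator F x / h x) = B.indicator (fun x => F x / h x) := by
      ext x; by_cases hx : x ∈ B <;> simp [hx]
    rw [this]
    refine memLp_of_indicator_bounded ?_ hB hBμ (C * n) ?_
    · exact (hF.aemeasurable.div (Complex.measurable_ofReal.comp hm).aemeasurable).aestronglyMeasurable
    · intro x hx
      rw [norm_div, Complex.norm_of_nonneg (h0 x).le, div_le_iff₀ (h0 x)]
      have := hBn x hx
      have hC : 0 ≤ C := (norm_nonneg _).trans (hBC x hx)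
      nlinarith [hBC x hx]
  let A : ℕ → Set α := fun n => {x | ‖Φ x‖ ≤ n ∧ 1 ≤ n * h x}
  have hA : ∀ n, MeasurableSet (A n) := fun n =>
    (measurableSet_le Φm.norm measurable_const).inter
      (measurableSet_le measurable_const (hm.const_mul _))
  have hAmono : Monotone A := by
    intro n k hnk x hx
    have : (n : ℝ) ≤ k := by exact_mod_cast hnk
    exact ⟨hx.1.trans this, hx.2.trans (by nlinarith [h0 x])⟩
  have hev : ∀ x, ∀ᶠ n : ℕ in atTop, 1 ≤ (n : ℝ) * h x := by
    intro x
    filter_upwards [(tendsto_natCast_atTop_atTop (R := ℝ)).eventually_ge_atTop (1 / h x)] with n hn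
    rwa [div_le_iff₀ (h0 x)] at hn
  have hAU : ⋃ n, A n = Set.univ := by
    refine Set.eq_univ_of_forall fun x => ?_
    have := ((tendsto_natCast_atTop_atTop (R := ℝ)).eventually_ge_atTop ‖Φ x‖).and (hev x)
    obtain ⟨n, hn⟩ := this.exists
    exact Set.mem_iUnion.2 ⟨n, hn.1, hn.2⟩
  have hbound : ∀ n, ∫⁻ x in A n, ‖Φ x‖ₑ ^ q' ∂μ ≤ ‖Λ‖ₑ ^ q' := by
    intro n
    set I := ∫⁻ x in A n, ‖Φ x‖ₑ ^ q' ∂μ with hI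
    -- The extremal function for Hölder's inequality: $\Phi F=|\Phi|^{q'}$ and $|F|^q=|\Phi|^{q'}$.
    let F : α → ℂ := fun x => starRingEnd ℂ (Φ x) * ((‖Φ x‖ ^ (q' - 2) : ℝ) : ℂ)
    have hFn : ∀ x, ‖F x‖ = ‖Φ x‖ ^ (q' - 1) := by
      intro x
      by_cases hx : Φ x = 0
      · simp only [F, hx]
        simp [Real.zero_rpow (by linarith : q' - 1 ≠ 0)]
      · simp only [F]
        rw [norm_mul, Complex.norm_of_nonneg (by positivity), RCLike.norm_conj,
          show q' - 1 = 1 + (q' - 2) by ring, Real.rpow_add (norm_pos_iff.2 hx), Real.rpow_one]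
    have hFF : ∀ x, Φ x * F x = ((‖Φ x‖ ^ q' : ℝ) : ℂ) := by
      intro x
      by_cases hx : Φ x = 0
      · simp [hx, Real.zero_rpow q'0.ne']
      · simp only [F]
        rw [← mul_assoc, Complex.mul_conj, ← Complex.ofReal_mul, Complex.normSq_eq_norm_sq]
        congr 1
        rw [show q' = 2 + (q' - 2) by ring, Real.rpow_add (norm_pos_iff.2 hx)]
        simp
    have hFm : Measurable F := by
      have := Complex.continuous_conj.measurable.comp Φm
      have h2 : Measurable fun x => ((‖Φ x‖ ^ (q' - 2) : ℝ) : ℂ) :=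
        Complex.measurable_ofReal.comp (Φm.norm.pow_const _)
      exact this.mul h2
    obtain ⟨m1, m2⟩ := hdiv F (A n) n ((n : ℝ) ^ (q' - 1)) hFm.aestronglyMeasurable (hA n)
      (fun x hx => hx.2) (fun x hx => by
        rw [hFn]; exact Real.rpow_le_rpow (norm_nonneg _) hx.1 (by linarith))
    -- The truncation makes $I$ finite a priori, which is what permits cancelling $I^{1/q}$ from
    -- $I\le\|\Lambda\|I^{1/q}$.
    have hIfin : I ≠ ∞ := by
      have : I ≤ ∫⁻ x in A n, (n : ℝ≥0∞) ^ q' ∂μ := by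
        refine setLIntegral_mono measurable_const fun x hx => ENNReal.rpow_le_rpow ?_ q'0.le
        rw [← ofReal_norm]
        exact (ENNReal.ofReal_le_ofReal hx.1).trans (by simp)
      refine ne_top_of_le_ne_top ?_ this
      rw [setLIntegral_const]
      refine ENNReal.mul_ne_top (ENNReal.rpow_ne_top_of_nonneg q'0.le (by simp)) ?_
      exact ne_of_lt (lt_of_le_of_lt (measure_mono fun x hx => hx.2) (hfin n).lt_top)
    have e1 := hrep _ m1 m2
    have en : ∀ x, ‖Φ x‖ₑ ^ q' = ENNReal.ofReal (‖Φ x‖ ^ q') := fun x => by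
      rw [← ofReal_norm, ENNReal.ofReal_rpow_of_nonneg (norm_nonneg _) q'0.le]
    have e2 : ∫ x, Φ x * (A n).indicator F x ∂μ = (I.toReal : ℂ) := by
      have : (fun x => Φ x * (A n).indicator F x)
          = (A n).indicator (fun x => ((‖Φ x‖ ^ q' : ℝ) : ℂ)) := by
        ext x
        by_cases hx : x ∈ A n <;> simp [hx, hFF]
      rw [this, integral_indicator (hA n), integral_complex_ofReal]
      congr 1
      rw [integral_eq_lintegral_of_nonneg_ae (Eventually.of_forall fun x => by positivity)
        (Φm.norm.pow_const _).aestronglyMeasurable, hI]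
      simp_rw [en]
    have e3 : ‖m1.toLp‖ₑ = I ^ (1 / q) := by
      rw [Lp.enorm_toLp, eLpNorm_eq_lintegral_rpow_enorm_toReal hqe0 ENNReal.ofReal_ne_top,
        ENNReal.toReal_ofReal q0.le, hI, ← lintegral_indicator (hA n)]
      congr 1
      refine lintegral_congr fun x => ?_
      by_cases hx : x ∈ A n
      · simp only [hx, Set.indicator_of_mem]
        rw [← ofReal_norm, hFn, ENNReal.ofReal_rpow_of_nonneg (by positivity) q0.le,
          ← Real.rpow_mul (norm_nonneg _), en]
        have := hqq.symm.sub_one_mul_conj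
        rw [this]
      · simp [hx, q0]
    have e4 : I ≤ ‖Λ‖ₑ * I ^ (1 / q) := by
      have := Λ.le_opENorm m1.toLp
      rw [e1, e2, e3] at this
      refine le_trans (le_of_eq ?_) this
      rw [← ofReal_norm, Complex.norm_of_nonneg ENNReal.toReal_nonneg,
        ENNReal.ofReal_toReal hIfin]
    by_cases hI0 : I = 0
    · rw [hI0]; exact zero_le
    have e5 : I ^ (1 / q') * I ^ (1 / q) ≤ ‖Λ‖ₑ * I ^ (1 / q) := by
      rw [← ENNReal.rpow_add _ _ hI0 hIfin]
      have : 1 / q' + 1 / q = 1 := by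
        have := hqq.inv_add_inv_eq_one; rw [one_div, one_div]; linarith
      rw [this, ENNReal.rpow_one]; exact e4
    have e6 : I ^ (1 / q') ≤ ‖Λ‖ₑ := by
      refine (ENNReal.mul_le_mul_iff_left ?_ ?_).1 e5
      · exact (ENNReal.rpow_pos (pos_iff_ne_zero.2 hI0) hIfin).ne'
      · exact ENNReal.rpow_ne_top_of_nonneg (by positivity) hIfin
    have := ENNReal.rpow_le_rpow e6 q'0.le
    rwa [← ENNReal.rpow_mul, one_div, inv_mul_cancel₀ q'0.ne', ENNReal.rpow_one] at this
  have hΦ : MemLp Φ (ENNReal.ofReal q') μ := by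
    refine ⟨Φm.aestronglyMeasurable, ?_⟩
    rw [eLpNorm_lt_top_iff_lintegral_rpow_enorm_lt_top hqe'0 ENNReal.ofReal_ne_top,
      ENNReal.toReal_ofReal q'0.le, ← setLIntegral_univ, ← hAU,
      setLIntegral_iUnion_of_directed _ hAmono.directed_le]
    refine lt_of_le_of_lt (iSup_le hbound) (ENNReal.rpow_lt_top_of_nonneg q'0.le (by simp))
  refine ⟨Φ, hΦ, fun f hf => ?_⟩
  obtain ⟨f', hf'm, hff'⟩ := hf.1
  have hf' : MemLp f' (ENNReal.ofReal q) μ := hf.ae_eq hff'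
  have e0 : hf.toLp = hf'.toLp := MemLp.toLp_congr _ _ hff'
  rw [e0, integral_congr_ae (g := fun x => Φ x * f' x) (hff'.mono fun x hx => by
    simp only [hx])]
  let B : ℕ → Set α := fun n => {x | ‖f' x‖ ≤ n ∧ 1 ≤ n * h x}
  have hB : ∀ n, MeasurableSet (B n) := fun n =>
    (measurableSet_le hf'm.measurable.norm measurable_const).inter
      (measurableSet_le measurable_const (hm.const_mul _))
  have hBx : ∀ x, ∀ᶠ n in atTop, x ∈ B n := fun x =>
    ((tendsto_natCast_atTop_atTop (R := ℝ)).eventually_ge_atTop ‖f' x‖).and (hev x)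
  have hd := fun n => hdiv f' (B n) n n hf'm.aestronglyMeasurable (hB n)
      (fun x hx => hx.2) (fun x hx => hx.1)
  have t1 : Tendsto (fun n => (hd n).1.toLp) atTop (𝓝 hf'.toLp) := by
    rw [Lp.tendsto_Lp_iff_tendsto_eLpNorm'' _ _ _ hf']
    exact tendsto_eLpNorm_sub_indicator hqe0 ENNReal.ofReal_ne_top hf' hB hBx
  have t2 := (Λ.continuous.tendsto _).comp t1
  have hconj : ENNReal.HolderConjugate (ENNReal.ofReal q') (ENNReal.ofReal q) :=
    hqq.symm.ennrealOfReal
  have hint : Integrable (fun x => Φ x * f' x) μ := hΦ.integrable_mul hf'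
  have t3 : Tendsto (fun n => ∫ x, Φ x * (B n).indicator f' x ∂μ) atTop
      (𝓝 (∫ x, Φ x * f' x ∂μ)) := by
    refine tendsto_integral_of_dominated_convergence (fun x => ‖Φ x * f' x‖) ?_ hint.norm ?_ ?_
    · intro n
      exact (Φm.mul (hf'm.measurable.indicator (hB n))).aestronglyMeasurable
    · intro n
      refine Eventually.of_forall fun x => ?_
      by_cases hx : x ∈ B n <;> simp [hx]; positivity
    · refine Eventually.of_forall fun x => ?_
      refine tendsto_const_nhds.congr' ?_
      filter_upwards [hBx x] with n hn
      simp [hn]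
  refine tendsto_nhds_unique t2 (t3.congr fun n => ?_)
  exact (hrep _ (hd n).1 (hd n).2).symm

end LpDuality

end Coorbit

namespace Coorbit

/-! ### Weighted Lebesgue spaces -/

section Weighted

variable {G : Type*} [Group G] [MeasurableSpace G] {μ : Measure G}

lemma normLw_eq_lintegral {v : G → ℝ} {p : ℝ} (hp : 0 < p) (f : G → ℂ) :
    normLw μ v p f = (∫⁻ x, ‖(v x : ℂ) * f x‖ₑ ^ p ∂μ) ^ (1 / p) := by
  unfold normLw
  rw [eLpNorm_eq_lintegral_rpow_enorm_toReal (by simpa using hp) ENNReal.ofReal_ne_top,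
    ENNReal.toReal_ofReal hp.le]

lemma normLw_rpow {v : G → ℝ} {p : ℝ} (hp : 0 < p) (f : G → ℂ) :
    normLw μ v p f ^ p = ∫⁻ x, ‖(v x : ℂ) * f x‖ₑ ^ p ∂μ := by
  rw [normLw_eq_lintegral hp, ← ENNReal.rpow_mul, one_div, inv_mul_cancel₀ hp.ne',
    ENNReal.rpow_one]

lemma MemLw.lintegral_lt_top {v : G → ℝ} {p : ℝ} (hp : 0 < p) {f : G → ℂ} (hf : MemLw μ v p f) :
    ∫⁻ x, ‖(v x : ℂ) * f x‖ₑ ^ p ∂μ < ∞ := by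
  rw [← normLw_rpow hp]
  exact ENNReal.rpow_lt_top_of_nonneg hp.le hf.2.ne

lemma MemLw.add {v : G → ℝ} {p : ℝ} {f g : G → ℂ} (hf : MemLw μ v p f) (hg : MemLw μ v p g) :
    MemLw μ v p (f + g) := by
  unfold MemLw
  have : (fun x => (v x : ℂ) * (f + g) x) = (fun x => (v x : ℂ) * f x) + fun x => v x * g x := by
    ext x; simp [mul_add]
  rw [this]; exact MemLp.add hf hg

lemma MemLw.const_smul {v : G → ℝ} {p : ℝ} {f : G → ℂ} (hf : MemLw μ v p f) (c : ℂ) :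
    MemLw μ v p (c • f) := by
  unfold MemLw
  have : (fun x => (v x : ℂ) * (c • f) x) = c • fun x => (v x : ℂ) * f x := by
    ext x; simp; ring
  rw [this]; exact MemLp.const_smul hf c

lemma MemLw.sub {v : G → ℝ} {p : ℝ} {f g : G → ℂ} (hf : MemLw μ v p f) (hg : MemLw μ v p g) :
    MemLw μ v p (f - g) := by
  have : f - g = f + (-1 : ℂ) • g := by ext x; simp; ring
  rw [this]; exact hf.add (hg.const_smul _)

lemma normLw_const_smul (v : G → ℝ) (p : ℝ) (f : G → ℂ) (c : ℂ) :
    normLw μ v p (c • f) = ‖c‖ₑ * normLw μ v p f := by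
  unfold normLw
  have : (fun x => (v x : ℂ) * (c • f) x) = c • fun x => (v x : ℂ) * f x := by
    ext x; simp; ring
  rw [this, eLpNorm_const_smul]

lemma normLw_mono {v v' : G → ℝ} {p : ℝ} {f g : G → ℂ}
    (h : ∀ x, ‖(v x : ℂ) * f x‖ ≤ ‖(v' x : ℂ) * g x‖) : normLw μ v p f ≤ normLw μ v' p g :=
  eLpNorm_mono h

lemma aestronglyMeasurable_of_memLw [TopologicalSpace G] [OpensMeasurableSpace G] {v : G → ℝ}
    (hv : Continuous v) (h0 : ∀ x, 0 < v x) {p : ℝ} {f : G → ℂ} (hf : MemLw μ v p f) :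
    AEStronglyMeasurable f μ := by
  have h1 : Measurable fun x => ((v x)⁻¹ : ℂ) :=
    (Complex.measurable_ofReal.comp hv.measurable).inv
  have h2 := h1.aemeasurable.mul hf.1.aemeasurable (μ := μ)
  refine (h2.congr (Eventually.of_forall fun x => ?_)).aestronglyMeasurable
  have : (v x : ℂ) ≠ 0 := by exact_mod_cast (h0 x).ne'
  simp [this]

/-- Hölder's inequality for the pairing of `L_{a,1/v}` with `L_{a',v}`. -/
lemma lintegral_enorm_mul_le {v : G → ℝ} (h0 : ∀ x, 0 < v x) {a a' : ℝ} (ha : a.HolderConjugate a')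
    {f F : G → ℂ} (hf : MemLw μ (fun x => (v x)⁻¹) a f) (hF : MemLw μ v a' F) :
    ∫⁻ x, ‖f x * F x‖ₑ ∂μ ≤ normLw μ (fun x => (v x)⁻¹) a f * normLw μ v a' F := by
  rw [normLw_eq_lintegral ha.pos, normLw_eq_lintegral ha.symm.pos]
  refine le_trans (le_of_eq (lintegral_congr fun x => ?_))
    (ENNReal.lintegral_mul_le_Lp_mul_Lq μ ha hf.1.enorm hF.1.enorm)
  have : (v x : ℂ) ≠ 0 := by exact_mod_cast (h0 x).ne'
  rw [Pi.mul_apply, ← enorm_mul]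
  congr 1
  push_cast
  field_simp

end Weighted

/-! ### A trilinear Young inequality -/

section Trilinear

variable {G : Type*} [TopologicalSpace G] [Group G] [IsTopologicalGroup G]
  [SecondCountableTopology G] [MeasurableSpace G] [BorelSpace G]
  (μ : Measure G) [μ.IsMulLeftInvariant] [SFinite μ]

/-- A trilinear Young inequality, for a symmetric kernel. -/
lemma lintegral_trilinear_lt_top {Φ F k : G → ℝ≥0∞} (hΦ : AEMeasurable Φ μ) (hF : AEMeasurable F μ)
    (hk : Measurable k) (ksymm : ∀ x, k x⁻¹ = k x) {a : ℝ} (ha : 1 < a)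
    (iΦ : ∫⁻ x, Φ x ^ a ∂μ < ∞) (iF : ∫⁻ x, F x ^ (2 * a / (2 * a - 1)) ∂μ < ∞)
    (ik : ∫⁻ x, k x ^ (2 * a / (2 * a - 1)) ∂μ < ∞) :
    ∫⁻ z : G × G, Φ z.1 * F z.2 * k (z.1⁻¹ * z.2) ∂(μ.prod μ) < ∞ := by
  set p := 2 * a / (2 * a - 1) with hp
  have hp0 : 0 < p := by rw [hp]; apply div_pos <;> linarith
  have hΦ1 : AEMeasurable (fun z : G × G => Φ z.1) (μ.prod μ) := hΦ.comp_fst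
  have hF2 : AEMeasurable (fun z : G × G => F z.2) (μ.prod μ) := hF.comp_snd
  have hk2 : Measurable (fun z : G × G => k (z.1⁻¹ * z.2)) := hk.comp (by fun_prop)
  -- Hölder with three factors, each omitting one of $\Phi,F,k$. The exponents satisfy $1/a+2/p=2$,
  -- so with the weights `e` the product of the powers is exactly $\Phi F k$.
  let f : Fin 3 → G × G → ℝ≥0∞ := ![fun z => F z.2 ^ p * k (z.1⁻¹ * z.2) ^ p,
    fun z => Φ z.1 ^ a * k (z.1⁻¹ * z.2) ^ p, fun z => Φ z.1 ^ a * F z.2 ^ p]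
  let e : Fin 3 → ℝ := ![1 - 1 / a, 1 / (2 * a), 1 / (2 * a)]
  have ha1 : 0 ≤ 1 - 1 / a := by
    rw [sub_nonneg, div_le_one (by linarith)]; exact ha.le
  have ha2 : 0 ≤ 1 / (2 * a) := by positivity
  have key := ENNReal.lintegral_prod_norm_pow_le (μ := μ.prod μ) Finset.univ (f := f) (p := e)
    (by
      intro i _
      fin_cases i
      · exact (hF2.pow_const _).mul (hk2.pow_const _).aemeasurable
      · exact (hΦ1.pow_const _).mul (hk2.pow_const _).aemeasurable
      · exact (hΦ1.pow_const _).mul (hF2.pow_const _))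
    (by simp only [e, Fin.sum_univ_three]; simp; field_simp; ring)
    (by
      intro i _
      fin_cases i
      · exact ha1
      · exact ha2
      · exact ha2)
  simp only [Fin.prod_univ_three] at key
  have eq : ∀ z : G × G, f 0 z ^ e 0 * f 1 z ^ e 1 * f 2 z ^ e 2
      = Φ z.1 * F z.2 * k (z.1⁻¹ * z.2) := by
    intro z
    simp only [f, e, Matrix.cons_val_zero, Matrix.cons_val_one, Matrix.cons_val]
    rw [ENNReal.mul_rpow_of_nonneg _ _ ha1, ENNReal.mul_rpow_of_nonneg _ _ ha2,
      ENNReal.mul_rpow_of_nonneg _ _ ha2]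
    simp only [← ENNReal.rpow_mul]
    generalize Φ z.1 = A
    generalize F z.2 = B
    generalize k (z.1⁻¹ * z.2) = C
    have h1 : A ^ (a * (1 / (2 * a))) * A ^ (a * (1 / (2 * a))) = A := by
      rw [← ENNReal.rpow_add_of_nonneg _ _ (by positivity) (by positivity)]
      have : a * (1 / (2 * a)) + a * (1 / (2 * a)) = 1 := by field_simp; norm_num
      rw [this, ENNReal.rpow_one]
    have h2 : ∀ B : ℝ≥0∞, B ^ (p * (1 - 1 / a)) * B ^ (p * (1 / (2 * a))) = B := by
      intro B
      rw [← ENNReal.rpow_add_of_nonneg _ _ (by positivity) (by positivity)]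
      have : p * (1 - 1 / a) + p * (1 / (2 * a)) = 1 := by
        rw [hp]
        have : 2 * a - 1 ≠ 0 := by linarith
        field_simp; ring
      rw [this, ENNReal.rpow_one]
    calc _ = (A ^ (a * (1 / (2 * a))) * A ^ (a * (1 / (2 * a))))
          * (B ^ (p * (1 - 1 / a)) * B ^ (p * (1 / (2 * a))))
          * (C ^ (p * (1 - 1 / a)) * C ^ (p * (1 / (2 * a)))) := by ring
      _ = _ := by rw [h1, h2, h2]
  simp_rw [eq] at key
  refine lt_of_le_of_lt key ?_
  have i0 : ∫⁻ z, f 0 z ∂(μ.prod μ) < ∞ := by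
    have hmeas : AEMeasurable (fun z : G × G => F z.2 ^ p * k (z.1⁻¹ * z.2) ^ p) (μ.prod μ) :=
      (hF2.pow_const _).mul (hk2.pow_const _).aemeasurable
    change ∫⁻ z : G × G, F z.2 ^ p * k (z.1⁻¹ * z.2) ^ p ∂(μ.prod μ) < ∞
    rw [lintegral_prod_symm _ hmeas]
    -- Symmetry of $k$ turns $x^{-1}y$ into the left translate $y^{-1}x$, so no modular function
    -- appears.
    have : ∀ y, ∫⁻ x, F y ^ p * k (x⁻¹ * y) ^ p ∂μ = F y ^ p * ∫⁻ x, k x ^ p ∂μ := by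
      intro y
      have hky : Measurable fun x => k (x⁻¹ * y) ^ p := by fun_prop
      rw [lintegral_const_mul _ hky]
      congr 1
      rw [← lintegral_mul_left_eq_self (fun x => k x ^ p) y⁻¹]
      refine lintegral_congr fun x => ?_
      rw [← ksymm (x⁻¹ * y)]; simp
    simp_rw [this]
    rw [lintegral_mul_const'' _ (hF.pow_const _)]
    exact ENNReal.mul_lt_top iF ik
  have i1 : ∫⁻ z, f 1 z ∂(μ.prod μ) < ∞ := by
    have hmeas : AEMeasurable (fun z : G × G => Φ z.1 ^ a * k (z.1⁻¹ * z.2) ^ p) (μ.prod μ) :=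
      (hΦ1.pow_const _).mul (hk2.pow_const _).aemeasurable
    change ∫⁻ z : G × G, Φ z.1 ^ a * k (z.1⁻¹ * z.2) ^ p ∂(μ.prod μ) < ∞
    rw [lintegral_prod _ hmeas]
    have : ∀ x, ∫⁻ y, Φ x ^ a * k (x⁻¹ * y) ^ p ∂μ = Φ x ^ a * ∫⁻ x, k x ^ p ∂μ := by
      intro x
      have hky : Measurable fun y => k (x⁻¹ * y) ^ p := by fun_prop
      rw [lintegral_const_mul _ hky]
      congr 1
      exact lintegral_mul_left_eq_self (fun y => k y ^ p) x⁻¹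
    simp_rw [this]
    rw [lintegral_mul_const'' _ (hΦ.pow_const _)]
    exact ENNReal.mul_lt_top iΦ ik
  have i2 : ∫⁻ z, f 2 z ∂(μ.prod μ) < ∞ := by
    change ∫⁻ z : G × G, Φ z.1 ^ a * F z.2 ^ p ∂(μ.prod μ) < ∞
    rw [lintegral_prod_mul (hΦ.pow_const _) (hF.pow_const _)]
    exact ENNReal.mul_lt_top iΦ iF
  refine ENNReal.mul_lt_top (ENNReal.mul_lt_top ?_ ?_) ?_
  · exact ENNReal.rpow_lt_top_of_nonneg ha1 i0.ne
  · exact ENNReal.rpow_lt_top_of_nonneg ha2 i1.ne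
  · exact ENNReal.rpow_lt_top_of_nonneg ha2 i2.ne

end Trilinear

namespace Setting

/-! ### The reproducing kernel -/

section Kernel

variable {G : Type*} [TopologicalSpace G] [Group G] [IsTopologicalGroup G]
  [MeasurableSpace G] [BorelSpace G] {μ : Measure G}
  {H : Type*} [NormedAddCommGroup H] [InnerProductSpace ℂ H] (S : Setting μ H)

/-- The reciprocal of the control weight. -/
noncomputable def wInv (x : G) : ℝ := (S.w x)⁻¹

lemma w_pos (x : G) : 0 < S.w x := S.isControlWeight.pos x

lemma K_continuous : Continuous S.K := S.voice_continuous _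

/-- By unitarity, right convolution with $K$ becomes the pairing with the voice transform of
$\pi(x)u$. The reproducing formulas, and the passage from densities to distributions, use this form.
-/
lemma K_inv_mul (y x : G) : S.K (y⁻¹ * x) = starRingEnd ℂ (S.voice (S.π x S.u) y) := by
  rw [← voice_pi]
  simp [voice]

/-- Hermitian symmetry of $K$ makes $|K|$ symmetric; this replaces unimodularity wherever the
argument of the kernel has to be inverted. -/
lemma norm_K_inv (x : G) : ‖S.K x⁻¹‖ = ‖S.K x‖ := by
  have := S.K_inv_mul x 1
  rw [mul_one] at this
  rw [this, RCLike.norm_conj, voice_pi]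
  simp

lemma enorm_wK_inv (x : G) : ‖(S.w x⁻¹ : ℂ) * S.K x⁻¹‖ₑ = ‖(S.w x : ℂ) * S.K x‖ₑ := by
  rw [← ofReal_norm, ← ofReal_norm, norm_mul, norm_mul, norm_K_inv, S.isControlWeight.symm]

/-- A linear isometry preserves inner products, so the norm identity in the setting polarises. -/
lemma integral_conj_voice_mul (v v' : H) :
    ∫ y, starRingEnd ℂ (S.voice v' y) * S.voice v y ∂μ = inner ℂ v' v := by
  let V : H →ₗᵢ[ℂ] Lp ℂ 2 μ :=
    { toFun := fun v => (S.voice_memLp v).toLp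
      map_add' := fun v v' => by
        rw [← MemLp.toLp_add]
        exact MemLp.toLp_congr _ _ (Eventually.of_forall fun x => by simp)
      map_smul' := fun c v => by
        rw [RingHom.id_apply, ← MemLp.toLp_const_smul]
        exact MemLp.toLp_congr _ _ (Eventually.of_forall fun x => by simp)
      norm_map' := fun v => by
        have := S.voice_isometry v
        change ‖(S.voice_memLp v).toLp‖ = ‖v‖
        rw [Lp.norm_toLp, this, toReal_enorm] }
  rw [← V.inner_map_map v' v, L2.inner_def]
  refine integral_congr_ae ?_
  filter_upwards [(S.voice_memLp v).coeFn_toLp, (S.voice_memLp v').coeFn_toLp] with y h1 h2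
  have e1 : V v y = S.voice v y := h1
  have e2 : V v' y = S.voice v' y := h2
  rw [e1, e2, RCLike.inner_apply, mul_comm]

/-- The reproducing formula `Vv * K = Vv`. -/
lemma conv_voice (v : H) (x : G) : conv μ (S.voice v) S.K x = S.voice v x := by
  unfold conv
  simp_rw [K_inv_mul]
  rw [show S.voice v x = inner ℂ (S.π x S.u) v from rfl, ← S.integral_conj_voice_mul]
  simp_rw [mul_comm]

lemma integral_K_mul_conj_voice (v : H) (y : G) :
    ∫ z, S.K (y⁻¹ * z) * starRingEnd ℂ (S.voice v z) ∂μ = starRingEnd ℂ (S.voice v y) := by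
  simp_rw [← voice_pi, mul_comm (S.voice _ _)]
  rw [S.integral_conj_voice_mul]
  simp [voice]

lemma integral_K_mul_K (y x : G) :
    ∫ z, S.K (y⁻¹ * z) * S.K (z⁻¹ * x) ∂μ = S.K (y⁻¹ * x) := by
  have := S.conv_voice (S.π y S.u) x
  rw [voice_pi] at this
  simp_rw [← this, conv, voice_pi]

lemma w_le_mul (x y : G) : S.w x ≤ S.w y * S.w (x⁻¹ * y) := by
  have h := S.isControlWeight.submul y (y⁻¹ * x)
  rw [mul_inv_cancel_left] at h
  rw [← S.isControlWeight.symm (x⁻¹ * y)]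
  simpa using h

lemma memLw_conj {v : G → ℝ} {p : ℝ} {f : G → ℂ} (hf : MemLw μ v p f) :
    MemLw μ v p fun x => starRingEnd ℂ (f x) := by
  unfold MemLw
  refine MemLp.congr_norm (MemLp.star hf) ?_ (Eventually.of_forall fun x => by simp)
  refine (Complex.continuous_conj.comp_aestronglyMeasurable hf.1).congr
    (Eventually.of_forall fun x => by simp)

end Kernel

/-! ### Pointwise reproduction on $L_{a,1/w}$ -/

section Haar

variable {G : Type*} [TopologicalSpace G] [Group G] [IsTopologicalGroup G] [LocallyCompactSpace G]
  [SecondCountableTopology G] [MeasurableSpace G] [BorelSpace G]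
  {μ : Measure G} [μ.IsHaarMeasure]
  {H : Type*} [NormedAddCommGroup H] [InnerProductSpace ℂ H] (S : Setting μ H)

lemma memLw_K_translate {p : ℝ} (hp : 1 < p) (x : G) : MemLw μ S.w p fun y => S.K (y⁻¹ * x) := by
  simp_rw [K_inv_mul]
  exact memLw_conj (S.pi_u_mem x p hp)

lemma aestronglyMeasurable_of_memLw_wInv {p : ℝ} {f : G → ℂ} (hf : MemLw μ S.wInv p f) :
    AEStronglyMeasurable f μ :=
  aestronglyMeasurable_of_memLw (S.isControlWeight.continuous.inv₀ fun x => (S.w_pos x).ne')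
    (fun x => inv_pos.2 (S.w_pos x)) hf

/-- The inequality $w(y)\le w(z)\,w(y^{-1}z)$ distributes the weights as $f/w$, $wF$, $wK$, and the
trilinear inequality applies with exponents $a,p,p$, $p=2a/(2a-1)$. Since $p>1$, the kernel is in
$L_{p,w}$ although it may fail to be integrable. -/
lemma integrable_mul_K_mul {a : ℝ} (ha : 1 < a) {f F : G → ℂ} (hf : MemLw μ S.wInv a f)
    (hF : MemLw μ S.w (2 * a / (2 * a - 1)) F) :
    Integrable (fun z : G × G => f z.1 * S.K (z.1⁻¹ * z.2) * F z.2) (μ.prod μ) := by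
  set p := 2 * a / (2 * a - 1) with hp
  have hp1 : 1 < p := by rw [hp, one_lt_div (by linarith)]; linarith
  have hfm := S.aestronglyMeasurable_of_memLw_wInv hf
  have hFm := aestronglyMeasurable_of_memLw S.isControlWeight.continuous S.w_pos hF
  refine ⟨?_, ?_⟩
  · refine (hfm.comp_fst.mul ?_).mul hFm.comp_snd
    exact (S.K_continuous.measurable.comp (by fun_prop)).aestronglyMeasurable
  · have key := lintegral_trilinear_lt_top μ hf.1.enorm hF.1.enorm
      (k := fun x => ‖(S.w x : ℂ) * S.K x‖ₑ)
      (((Complex.continuous_ofReal.comp S.isControlWeight.continuous).mul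
        S.K_continuous).enorm.measurable) (S.enorm_wK_inv) ha
      (hf.lintegral_lt_top (by linarith)) (hF.lintegral_lt_top (by linarith))
      ((S.kernel_mem p hp1).lintegral_lt_top (by linarith))
    refine lt_of_le_of_lt (lintegral_mono fun z => ?_) key
    simp only [← ofReal_norm]
    rw [← ENNReal.ofReal_mul (norm_nonneg _), ← ENNReal.ofReal_mul (by positivity)]
    apply ENNReal.ofReal_le_ofReal
    simp only [norm_mul, Complex.norm_real, Real.norm_of_nonneg (S.w_pos _).le,
      wInv, Real.norm_of_nonneg (inv_nonneg.2 (S.w_pos _).le)]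
    have h1 := S.w_le_mul z.1 z.2
    have h2 : 1 ≤ (S.w z.1)⁻¹ * (S.w z.2 * S.w (z.1⁻¹ * z.2)) := by
      rw [inv_mul_eq_div, one_le_div (S.w_pos _)]; exact h1
    calc ‖f z.1‖ * ‖S.K (z.1⁻¹ * z.2)‖ * ‖F z.2‖
        ≤ ((S.w z.1)⁻¹ * (S.w z.2 * S.w (z.1⁻¹ * z.2)))
          * (‖f z.1‖ * ‖S.K (z.1⁻¹ * z.2)‖ * ‖F z.2‖) := le_mul_of_one_le_left (by positivity) h2
      _ = _ := by ring

/-- Fubini's theorem for `∫ (f * K) F`. -/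
lemma integral_conv_K_mul {a : ℝ} (ha : 1 < a) {f F : G → ℂ} (hf : MemLw μ S.wInv a f)
    (hF : MemLw μ S.w (2 * a / (2 * a - 1)) F) :
    ∫ z, conv μ f S.K z * F z ∂μ = ∫ y, f y * ∫ z, S.K (y⁻¹ * z) * F z ∂μ ∂μ := by
  have hI := S.integrable_mul_K_mul ha hf hF
  have := integral_integral_swap (f := fun y z => f y * S.K (y⁻¹ * z) * F z) hI
  simp only [conv]
  simp_rw [← integral_mul_const, ← integral_const_mul, ← mul_assoc]
  exact this.symm

lemma one_lt_exponent {a : ℝ} (ha : 1 < a) : 1 < 2 * a / (2 * a - 1) := by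
  rw [one_lt_div (by linarith)]; linarith

/-- `f * K` is reproduced by `K`, at every point. -/
lemma conv_conv_K {a : ℝ} (ha : 1 < a) {f : G → ℂ} (hf : MemLw μ S.wInv a f) (x : G) :
    conv μ (conv μ f S.K) S.K x = conv μ f S.K x := by
  have := S.integral_conv_K_mul ha hf (S.memLw_K_translate (one_lt_exponent ha) x)
  simp_rw [integral_K_mul_K] at this
  exact this

lemma integrable_mul_K {a : ℝ} (ha : 1 < a) {f : G → ℂ} (hf : MemLw μ S.wInv a f) (x : G) :
    Integrable (fun y => f y * S.K (y⁻¹ * x)) μ := by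
  have hc := (Real.HolderConjugate.conjExponent ha)
  have hK := S.memLw_K_translate hc.symm.lt x
  refine ⟨(S.aestronglyMeasurable_of_memLw_wInv hf).mul
    (S.K_continuous.comp (by fun_prop)).aestronglyMeasurable, ?_⟩
  exact lt_of_le_of_lt (lintegral_enorm_mul_le S.w_pos hc hf hK)
    (ENNReal.mul_lt_top hf.2 hK.2)

/-- Point evaluations of `f * K` are bounded. -/
lemma exists_enorm_conv_K_le {a : ℝ} (ha : 1 < a) (x : G) :
    ∃ C : ℝ≥0∞, C ≠ ∞ ∧ ∀ f : G → ℂ, MemLw μ S.wInv a f →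
      ‖conv μ f S.K x‖ₑ ≤ C * normLw μ S.wInv a f := by
  have hc := (Real.HolderConjugate.conjExponent ha)
  have hK := S.memLw_K_translate hc.symm.lt x
  refine ⟨_, hK.2.ne, fun f hf => ?_⟩
  rw [mul_comm]
  exact (enorm_integral_le_lintegral_enorm _).trans (lintegral_enorm_mul_le S.w_pos hc hf hK)

lemma conv_K_add {a : ℝ} (ha : 1 < a) {f g : G → ℂ} (hf : MemLw μ S.wInv a f)
    (hg : MemLw μ S.wInv a g) : conv μ (f + g) S.K = conv μ f S.K + conv μ g S.K := by
  ext x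
  simp only [conv, Pi.add_apply, add_mul]
  exact integral_add (S.integrable_mul_K ha hf x) (S.integrable_mul_K ha hg x)

lemma conv_K_smul (c : ℂ) (f : G → ℂ) : conv μ (c • f) S.K = c • conv μ f S.K := by
  ext x
  simp only [conv, Pi.smul_apply, smul_eq_mul, mul_assoc]
  exact integral_const_mul _ _

lemma conv_K_sub {a : ℝ} (ha : 1 < a) {f g : G → ℂ} (hf : MemLw μ S.wInv a f)
    (hg : MemLw μ S.wInv a g) : conv μ (f - g) S.K = conv μ f S.K - conv μ g S.K := by
  ext x
  simp only [conv, Pi.sub_apply, sub_mul]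
  exact integral_sub (S.integrable_mul_K ha hf x) (S.integrable_mul_K ha hg x)

/-- Moderate weights dominate `1 / w`. -/
lemma normLw_wInv_le {m : G → ℝ} (hm : IsModerate S.w m) {r : ℝ} (f : G → ℂ) :
    normLw μ S.wInv r f ≤ ENNReal.ofReal (m 1)⁻¹ * normLw μ m r f := by
  have h1 : normLw μ S.wInv r f ≤ normLw μ m r ((((m 1)⁻¹ : ℝ) : ℂ) • f) := by
    refine normLw_mono fun x => ?_
    simp only [norm_mul, Pi.smul_apply, norm_smul, Complex.norm_real]
    rw [Real.norm_of_nonneg (hm.pos _).le, Real.norm_of_nonneg (inv_nonneg.2 (hm.pos _).le), wInv,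
      Real.norm_of_nonneg (inv_nonneg.2 (S.w_pos _).le), ← mul_assoc]
    gcongr
    have h := hm.right x x⁻¹
    rw [mul_inv_cancel, S.isControlWeight.symm] at h
    rw [← div_eq_mul_inv, inv_eq_one_div, div_le_div_iff₀ (S.w_pos _) (hm.pos _)]
    linarith
  refine h1.trans (le_of_eq ?_)
  rw [normLw_const_smul, ← ofReal_norm, Complex.norm_real,
    Real.norm_of_nonneg (inv_nonneg.2 (hm.pos _).le)]

lemma memLw_wInv {m : G → ℝ} (hm : IsModerate S.w m) {r : ℝ} {f : G → ℂ} (hf : MemLw μ m r f) :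
    MemLw μ S.wInv r f := by
  refine ⟨?_, lt_of_le_of_lt (S.normLw_wInv_le hm f)
    (ENNReal.mul_lt_top ENNReal.ofReal_lt_top hf.2)⟩
  exact (Complex.continuous_ofReal.comp (S.isControlWeight.continuous.inv₀
    fun x => (S.w_pos x).ne')).aestronglyMeasurable.mul
    (aestronglyMeasurable_of_memLw hm.continuous hm.pos hf)

end Haar

end Setting

end Coorbit

namespace Coorbit

/-! ### Boundedness of right convolution with the kernel -/

section WeightedLp

variable {G : Type*} [MeasurableSpace G] {μ : Measure G} {v : G → ℝ} {p : ℝ}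

/-- The class of `v f` in `L_p(G)`, for `f ∈ L_{p,v}(G)`. -/
noncomputable def MemLw.toLw {f : G → ℂ} (hf : MemLw μ v p f) : Lp ℂ (ENNReal.ofReal p) μ :=
  MemLp.toLp (fun x => (v x : ℂ) * f x) hf

lemma MemLw.coeFn_toLw {f : G → ℂ} (hf : MemLw μ v p f) :
    hf.toLw =ᵐ[μ] fun x => (v x : ℂ) * f x := MemLp.coeFn_toLp _

lemma MemLw.enorm_toLw {f : G → ℂ} (hf : MemLw μ v p f) : ‖hf.toLw‖ₑ = normLw μ v p f :=
  Lp.enorm_toLp _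

lemma MemLw.norm_toLw {f : G → ℂ} (hf : MemLw μ v p f) :
    ‖hf.toLw‖ = (normLw μ v p f).toReal :=
  Lp.norm_toLp _ _

lemma MemLw.toLw_eq_add {f g h : G → ℂ} (hf : MemLw μ v p f) (hg : MemLw μ v p g)
    (hh : MemLw μ v p h) (e : h = f + g) : hh.toLw = hf.toLw + hg.toLw :=
  (MemLp.toLp_congr hh (MemLp.add hf hg) (Eventually.of_forall fun x => by
    simp [e, mul_add])).trans (MemLp.toLp_add hf hg)

lemma MemLw.toLw_eq_smul {f h : G → ℂ} {c : ℂ} (hf : MemLw μ v p f)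
    (hh : MemLw μ v p h) (e : h = c • f) : hh.toLw = c • hf.toLw :=
  (MemLp.toLp_congr hh (MemLp.const_smul hf c) (Eventually.of_forall fun x => by
    simp [e]; ring)).trans (MemLp.toLp_const_smul c hf)

end WeightedLp

namespace Setting

variable {G : Type*} [TopologicalSpace G] [Group G] [IsTopologicalGroup G] [LocallyCompactSpace G]
  [SecondCountableTopology G] [MeasurableSpace G] [BorelSpace G]
  {μ : Measure G} [μ.IsHaarMeasure]
  {H : Type*} [NormedAddCommGroup H] [InnerProductSpace ℂ H] (S : Setting μ H)

lemma conv_congr_ae {f g k : G → ℂ} (h : f =ᵐ[μ] g) : conv μ f k = conv μ g k := by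
  ext x
  exact integral_congr_ae (h.mono fun y hy => by simp only [hy])

/-- Bounded point evaluations turn norm convergence into convergence at every point; this is how
limits in different spaces are later compared. -/
lemma tendsto_conv_K {a : ℝ} (ha : 1 < a) {f : ℕ → G → ℂ} {g : G → ℂ}
    (hf : ∀ n, MemLw μ S.wInv a (f n)) (hg : MemLw μ S.wInv a g)
    (h : Tendsto (fun n => normLw μ S.wInv a (f n - g)) atTop (𝓝 0)) (x : G) :
    Tendsto (fun n => conv μ (f n) S.K x) atTop (𝓝 (conv μ g S.K x)) := by
  obtain ⟨C, hC, hb⟩ := S.exists_enorm_conv_K_le ha x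
  rw [tendsto_iff_edist_tendsto_0]
  have h1 := ENNReal.Tendsto.const_mul h (Or.inr hC)
  rw [mul_zero] at h1
  refine tendsto_of_tendsto_of_tendsto_of_le_of_le tendsto_const_nhds h1 (fun n => zero_le)
    fun n => ?_
  have := hb _ ((hf n).sub hg)
  rw [S.conv_K_sub ha (hf n) hg, Pi.sub_apply] at this
  rwa [edist_eq_enorm_sub]

lemma tendsto_conv_K_of_moderate {m : G → ℝ} (hm : IsModerate S.w m) {r : ℝ} (hr : 1 < r)
    {f : ℕ → G → ℂ} {g : G → ℂ} (hf : ∀ n, MemLw μ m r (f n)) (hg : MemLw μ m r g)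
    (h : Tendsto (fun n => normLw μ m r (f n - g)) atTop (𝓝 0)) (x : G) :
    Tendsto (fun n => conv μ (f n) S.K x) atTop (𝓝 (conv μ g S.K x)) := by
  refine S.tendsto_conv_K hr (fun n => S.memLw_wInv hm (hf n)) (S.memLw_wInv hm hg) ?_ x
  have h1 := ENNReal.Tendsto.const_mul h (Or.inr (ENNReal.ofReal_ne_top (r := (m 1)⁻¹)))
  rw [mul_zero] at h1
  exact tendsto_of_tendsto_of_tendsto_of_le_of_le tendsto_const_nhds h1 (fun n => zero_le)
    fun n => S.normLw_wInv_le hm _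

lemma mul_div_weight {m : G → ℝ} (h0 : ∀ x, 0 < m x) (F : G → ℂ) (x : G) :
    (m x : ℂ) * (F x / m x) = F x := by
  have : (m x : ℂ) ≠ 0 := by exact_mod_cast (h0 x).ne'
  field_simp

lemma memLw_div_weight {m : G → ℝ} (h0 : ∀ x, 0 < m x) {r : ℝ} {F : G → ℂ}
    (hF : MemLp F (ENNReal.ofReal r) μ) : MemLw μ m r fun x => F x / m x := by
  unfold MemLw
  simp_rw [mul_div_weight h0]
  exact hF

lemma normLw_div_weight {m : G → ℝ} (h0 : ∀ x, 0 < m x) {r : ℝ} (F : G → ℂ) :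
    normLw μ m r (fun x => F x / m x) = eLpNorm F (ENNReal.ofReal r) μ := by
  unfold normLw
  simp_rw [mul_div_weight h0]

/-- Right convolution with `K` is bounded on `L_{r,m}` as soon as it is well-defined. -/
lemma exists_normLw_conv_K_le {m : G → ℝ} (hm : IsModerate S.w m) {r : ℝ} (hr : 1 < r)
    (hK : RightConvWellDefined μ m r S.K) :
    ∃ C : ℝ≥0, ∀ f : G → ℂ, MemLw μ m r f →
      normLw μ m r (conv μ f S.K) ≤ C * normLw μ m r f := by
  have : Fact (1 ≤ ENNReal.ofReal r) := ⟨by simpa using hr.le⟩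
  have hd : ∀ F : Lp ℂ (ENNReal.ofReal r) μ, MemLw μ m r fun x => F x / m x :=
    fun F => memLw_div_weight hm.pos (Lp.memLp F)
  let L : Lp ℂ (ENNReal.ofReal r) μ →ₗ[ℂ] Lp ℂ (ENNReal.ofReal r) μ :=
    { toFun := fun F => (hK _ (hd F)).2.toLw
      map_add' := fun F F' => by
        refine MemLw.toLw_eq_add _ _ _ ?_
        have e : (fun x => (F + F') x / (m x : ℂ)) =ᵐ[μ]
            (fun x => F x / (m x : ℂ)) + fun x => F' x / (m x : ℂ) := by
          filter_upwards [Lp.coeFn_add F F'] with x hx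
          rw [hx]; simp [add_div]
        rw [conv_congr_ae e, S.conv_K_add hr (S.memLw_wInv hm (hd F)) (S.memLw_wInv hm (hd F'))]
      map_smul' := fun c F => by
        refine MemLw.toLw_eq_smul _ _ ?_
        have e : (fun x => (c • F) x / (m x : ℂ)) =ᵐ[μ] c • fun x => F x / (m x : ℂ) := by
          filter_upwards [Lp.coeFn_smul c F] with x hx
          rw [hx]; simp [mul_div_assoc]
        rw [conv_congr_ae e, S.conv_K_smul, RingHom.id_apply] }
  have hL : Continuous L := by
    -- Closed graph: along a subsequence the images converge a.e. to the norm limit, while the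
    -- convolutions converge at every point to the convolution of the limit.
    refine L.continuous_of_seq_closed_graph fun u F y hu hLu => ?_
    obtain ⟨ns, hns, hae⟩ := (tendstoInMeasure_of_tendsto_Lp hLu).exists_seq_tendsto_ae
    have hpt := S.tendsto_conv_K_of_moderate hm hr (fun n => hd (u n)) (hd F) (by
      rw [Lp.tendsto_Lp_iff_tendsto_eLpNorm'] at hu
      refine hu.congr fun n => ?_
      rw [← normLw_div_weight hm.pos]
      refine congrArg (normLw μ m r) ?_
      ext x; simp [sub_div])
    apply Lp.ext
    have h2 : ∀ᵐ x ∂μ, ∀ n, L (u n) x = m x * conv μ (fun x => u n x / m x) S.K x :=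
      ae_all_iff.2 fun n => (hK _ (hd (u n))).2.coeFn_toLw
    have h3 : L F =ᵐ[μ] fun x => m x * conv μ (fun x => F x / m x) S.K x :=
      (hK _ (hd F)).2.coeFn_toLw
    filter_upwards [hae, h2, h3] with x h4 h5 h6
    rw [h6]
    refine tendsto_nhds_unique h4 ?_
    simp only [Function.comp_apply]
    simp_rw [h5]
    exact ((hpt x).comp hns.tendsto_atTop).const_mul _
  let L' : Lp ℂ (ENNReal.ofReal r) μ →L[ℂ] Lp ℂ (ENNReal.ofReal r) μ := ⟨L, hL⟩
  refine ⟨‖L'‖₊, fun f hf => ?_⟩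
  have key := L'.le_opENorm hf.toLw
  rw [hf.enorm_toLw] at key
  refine le_trans (le_of_eq ?_) key
  have e0 : (fun x => hf.toLw x / (m x : ℂ)) =ᵐ[μ] f := by
    filter_upwards [hf.coeFn_toLw] with x hx
    have : (m x : ℂ) ≠ 0 := by exact_mod_cast (hm.pos x).ne'
    rw [hx]; field_simp
  have e1 : L' hf.toLw = (hK _ (hd hf.toLw)).2.toLw := rfl
  rw [e1, MemLw.enorm_toLw, conv_congr_ae e0]

lemma rightConvNorm_ne_top {m : G → ℝ} (hm : IsModerate S.w m) {r : ℝ} (hr : 1 < r)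
    (hK : RightConvWellDefined μ m r S.K) : rightConvNorm μ m r S.K ≠ ∞ := by
  obtain ⟨C, hC⟩ := S.exists_normLw_conv_K_le hm hr hK
  refine ne_top_of_le_ne_top (ENNReal.coe_ne_top (r := C)) (iSup₂_le fun f hf => ?_)
  exact (hC f hf.1).trans (mul_le_of_le_one_right' hf.2)

lemma normLw_conv_K_le {m : G → ℝ} (hm : IsModerate S.w m) {r : ℝ} (hr : 1 < r)
    (hK : RightConvWellDefined μ m r S.K) {f : G → ℂ} (hf : MemLw μ m r f) :
    normLw μ m r (conv μ f S.K) ≤ rightConvNorm μ m r S.K * normLw μ m r f := by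
  obtain ⟨C, hC⟩ := S.exists_normLw_conv_K_le hm hr hK
  set N := normLw μ m r f with hN
  have hNt : N ≠ ∞ := hf.2.ne
  -- A function of norm zero cannot be normalised, so the bound by the closed graph constant $C$
  -- handles it.
  by_cases h0 : N = 0
  · have := hC f hf
    rw [← hN, h0, mul_zero] at this
    exact this.trans zero_le
  have hNr : 0 < N.toReal := ENNReal.toReal_pos h0 hNt
  let c : ℂ := ((N.toReal⁻¹ : ℝ) : ℂ)
  have hc : ‖c‖ₑ = N⁻¹ := by
    rw [← ofReal_norm, Complex.norm_real, Real.norm_of_nonneg (by positivity),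
      ENNReal.ofReal_inv_of_pos hNr, ENNReal.ofReal_toReal hNt]
  have h1 : normLw μ m r (c • f) ≤ 1 := by
    rw [normLw_const_smul, hc, ← hN, ENNReal.inv_mul_cancel h0 hNt]
  have h2 : normLw μ m r (conv μ (c • f) S.K) ≤ rightConvNorm μ m r S.K :=
    le_iSup₂ (f := fun (f : G → ℂ) (_ : MemLw μ m r f ∧ normLw μ m r f ≤ 1) =>
      normLw μ m r (conv μ f S.K)) (c • f) ⟨hf.const_smul c, h1⟩
  rw [S.conv_K_smul, normLw_const_smul, hc] at h2
  rw [mul_comm]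
  rwa [ENNReal.inv_mul_le_iff h0 hNt] at h2

/-! ### Distributions and their voice transforms -/

section Distributions

/-- Hölder in $Vv=Vv*K$ gives $w|Vv|\le\|K\|_{L_{q',w}}\|Vv\|_{L_{q,w}}$ everywhere, since $w(x)\le
w(y)w(x^{-1}y)$. Interpolating this sup bound with the $L_{q,w}$ norm yields all larger exponents.
-/
lemma normLw_voice_le {q p : ℝ} (hq : 1 < q) (hqp : q ≤ p) :
    ∃ C : ℝ≥0, ∀ v ∈ S.testSubmodule,
      normLw μ S.w p (S.voice v) ≤ C * normLw μ S.w q (S.voice v) := by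
  have hc := Real.HolderConjugate.conjExponent hq
  set q' := q.conjExponent
  set N := normLw μ S.w q' S.K with hN
  have hNt : N ≠ ∞ := (S.kernel_mem q' hc.symm.lt).2.ne
  have p0 : 0 < p := by linarith
  have q0 : 0 < q := by linarith
  have hCt : N ^ ((p - q) / p) ≠ ∞ :=
    ENNReal.rpow_ne_top_of_nonneg (div_nonneg (by linarith) p0.le) hNt
  refine ⟨(N ^ ((p - q) / p)).toNNReal, fun v hv => ?_⟩
  rw [ENNReal.coe_toNNReal hCt]
  set A := normLw μ S.w q (S.voice v) with hA
  have hsup : ∀ x, ‖(S.w x : ℂ) * S.voice v x‖ₑ ≤ N * A := by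
    intro x
    rw [← S.conv_voice v x, conv, ← integral_const_mul]
    refine (enorm_integral_le_lintegral_enorm _).trans ?_
    have h1 : ∫⁻ y, ‖(S.w y : ℂ) * S.voice v y‖ₑ *
        ‖(S.w (x⁻¹ * y) : ℂ) * S.K (x⁻¹ * y)‖ₑ ∂μ ≤ A * N := by
      have hk : Measurable fun y => ‖(S.w (x⁻¹ * y) : ℂ) * S.K (x⁻¹ * y)‖ₑ :=
        (((Complex.continuous_ofReal.comp S.isControlWeight.continuous).mul
          S.K_continuous).comp (by fun_prop : Continuous fun y : G => x⁻¹ * y)).enorm.measurable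
      refine (ENNReal.lintegral_mul_le_Lp_mul_Lq μ hc (hv q hq).1.enorm hk.aemeasurable).trans ?_
      rw [hA, hN, normLw_eq_lintegral q0, normLw_eq_lintegral hc.symm.pos,
        lintegral_mul_left_eq_self (fun y => ‖(S.w y : ℂ) * S.K y‖ₑ ^ q') x⁻¹]
    rw [mul_comm N A]
    refine le_trans (lintegral_mono fun y => ?_) h1
    simp only [← ofReal_norm]
    rw [← ENNReal.ofReal_mul (norm_nonneg _)]
    apply ENNReal.ofReal_le_ofReal
    simp only [norm_mul, Complex.norm_real, Real.norm_of_nonneg (S.w_pos _).le]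
    have e : ‖S.K (y⁻¹ * x)‖ = ‖S.K (x⁻¹ * y)‖ := by
      rw [← norm_K_inv]; simp
    rw [e]
    calc S.w x * (‖S.voice v y‖ * ‖S.K (x⁻¹ * y)‖)
        ≤ (S.w y * S.w (x⁻¹ * y)) * (‖S.voice v y‖ * ‖S.K (x⁻¹ * y)‖) := by
          gcongr; exact S.w_le_mul x y
      _ = _ := by ring
  have hAt : A ≠ ∞ := (hv q hq).2.ne
  have h2 : ∫⁻ x, ‖(S.w x : ℂ) * S.voice v x‖ₑ ^ p ∂μ ≤ (N * A) ^ (p - q) * A ^ q := by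
    rw [hA, normLw_rpow q0, ← hA, ← lintegral_const_mul']
    · refine lintegral_mono fun x => ?_
      have : p = (p - q) + q := by ring
      nth_rewrite 1 [this]
      rw [ENNReal.rpow_add_of_nonneg _ _ (by linarith) q0.le]
      gcongr
      exact hsup x
    · exact ENNReal.rpow_ne_top_of_nonneg (by linarith) (ENNReal.mul_ne_top hNt hAt)
  rw [normLw_eq_lintegral p0]
  refine (ENNReal.rpow_le_rpow h2 (by positivity : 0 ≤ 1 / p)).trans (le_of_eq ?_)
  have hpq : 0 ≤ p - q := by linarith
  rw [ENNReal.mul_rpow_of_nonneg _ _ hpq, mul_assoc,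
    ← ENNReal.rpow_add_of_nonneg _ _ hpq q0.le, ENNReal.mul_rpow_of_nonneg _ _ (by positivity),
    ← ENNReal.rpow_mul, ← ENNReal.rpow_mul]
  have e1 : (p - q) * (1 / p) = (p - q) / p := by ring
  have e2 : (p - q + q) * (1 / p) = 1 := by field_simp; ring
  rw [e1, e2, ENNReal.rpow_one]

/-- A distribution is bounded by a single one of the defining seminorms. -/
lemma exists_bound_distribution (T : S.Distribution) :
    ∃ q : ℝ, 1 < q ∧ q < 2 ∧ ∃ C : ℝ≥0, ∀ v : S.TestSpace,
      ‖T v‖ ≤ C * (normLw μ S.w q (S.voice v.1)).toReal := by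
  have hT : Continuous ((normSeminorm ℂ ℂ).comp T.toLinearMap) :=
    continuous_norm.comp T.continuous
  obtain ⟨s, C, -, hs⟩ := Seminorm.bound_of_continuous S.testSpace_withSeminorms _ hT
  -- The smallest exponent controls all the others. Inserting $3/2$ makes the finite set nonempty
  -- and forces $q<2$.
  obtain ⟨q, hq⟩ : ∃ q : {p : ℝ // 1 < p},
      ∀ p ∈ insert (⟨3 / 2, by norm_num⟩ : {p : ℝ // 1 < p}) s, q ≤ p :=
    ⟨Finset.min' _ (Finset.insert_nonempty _ s), fun p hp => Finset.min'_le _ p hp⟩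
  have hq2 : q.1 < 2 := by
    have : q.1 ≤ 3 / 2 := hq _ (Finset.mem_insert_self _ _)
    linarith
  have hD : ∀ p ∈ s, ∃ D : ℝ≥0, ∀ v ∈ S.testSubmodule,
      normLw μ S.w p.1 (S.voice v) ≤ D * normLw μ S.w q.1 (S.voice v) := fun p hp =>
    S.normLw_voice_le q.2 (hq p (Finset.mem_insert_of_mem hp))
  choose! D hD using hD
  refine ⟨q.1, q.2, hq2, C * s.sup D, fun v => ?_⟩
  have h1 := hs v
  refine h1.trans ?_
  rw [smul_apply, NNReal.coe_mul, mul_assoc]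
  change (C : ℝ) * _ ≤ _
  gcongr
  refine Seminorm.finset_sup_apply_le (by positivity) fun p hp => ?_
  have h2 := hD p hp v.1 v.2
  have h3 : normLw μ S.w p.1 (S.voice v.1) ≤ (s.sup D : ℝ≥0) * normLw μ S.w q.1 (S.voice v.1) :=
    h2.trans (by gcongr; exact Finset.le_sup (f := D) hp)
  have h4 : normLw μ S.w q.1 (S.voice v.1) ≠ ∞ := (v.2 q.1 q.2).2.ne
  have h5 := ENNReal.toReal_mono (ENNReal.mul_ne_top ENNReal.coe_ne_top h4) h3
  rwa [ENNReal.toReal_mul, ENNReal.coe_toReal] at h5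

/-- Distributions are given by integration against functions in some `L_{a,1/w}`. -/
lemma exists_density_distribution (T : S.Distribution) :
    ∃ (a : ℝ) (Φ : G → ℂ), 1 < a ∧ MemLw μ S.wInv a Φ ∧
      ∀ v : S.TestSpace, T v = ∫ x, Φ x * starRingEnd ℂ (S.voice v.1 x) ∂μ := by
  obtain ⟨q, hq, hq2, C, hC⟩ := S.exists_bound_distribution T
  have : Fact (1 ≤ ENNReal.ofReal q) := ⟨by simpa using hq.le⟩
  let A : S.TestSpace →ₗ[ℂ] Lp ℂ (ENNReal.ofReal q) μ :=
    { toFun := fun v => (v.2 q hq).toLw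
      map_add' := fun v v' => MemLw.toLw_eq_add _ _ _ (S.voice_add v.1 v'.1)
      map_smul' := fun c v => MemLw.toLw_eq_smul _ _ (S.voice_smul c v.1) }
  have hA : ∀ v, ‖A v‖ = (normLw μ S.w q (S.voice v.1)).toReal := fun v => (v.2 q hq).norm_toLw
  let ℓ : S.TestSpace →ₗ[ℂ] ℂ :=
    { toFun := fun v => starRingEnd ℂ (T v)
      map_add' := fun v v' => by simp
      map_smul' := fun c v => by simp }
  have hℓ : ∀ v, ‖ℓ v‖ ≤ C * ‖A v‖ := fun v => by
    rw [hA]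
    change ‖starRingEnd ℂ (T v)‖ ≤ _
    rw [RCLike.norm_conj]; exact hC v
  have hker : A.ker ≤ ℓ.ker := fun v hv => by
    rw [LinearMap.mem_ker] at hv ⊢
    have := hℓ v
    rw [hv, norm_zero, mul_zero] at this
    exact norm_le_zero_iff.1 this
  -- The bound shows that $\overline{T(v)}$ depends only on the class of $w\,Vv$ in $L_q$, so it
  -- descends to the range of `A`, from where Hahn-Banach extends it to $L_q$.
  let φ : A.range →ₗ[ℂ] ℂ := (A.ker.liftQ ℓ hker) ∘ₗ A.quotKerEquivRange.symm.toLinearMap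
  have hφ : ∀ (v : S.TestSpace) (h : A v ∈ A.range), φ ⟨A v, h⟩ = ℓ v := fun v h => by
    simp only [φ, LinearMap.comp_apply, LinearEquiv.coe_coe]
    rw [LinearMap.quotKerEquivRange_symm_apply_image]
    simp
  let φ' : StrongDual ℂ A.range := φ.mkContinuous C (by
    rintro ⟨y, hy⟩
    obtain ⟨v, rfl⟩ := LinearMap.mem_range.1 hy
    rw [hφ v hy]; exact hℓ v)
  obtain ⟨Λ, hΛ, -⟩ := exists_extension_norm_eq A.range φ'
  have hΛA : ∀ v, Λ (A v) = ℓ v := fun v => by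
    rw [← hφ v (LinearMap.mem_range_self A v)]
    exact hΛ ⟨A v, LinearMap.mem_range_self A v⟩
  have hc := Real.HolderConjugate.conjExponent hq
  obtain ⟨Φ, hΦ, hrep⟩ := exists_dual_representation hc hq2 Λ
  have hwI : (fun x => (S.wInv x : ℂ) * (S.w x * starRingEnd ℂ (Φ x)))
      = fun x => starRingEnd ℂ (Φ x) := by
    ext x
    have : (S.w x : ℂ) ≠ 0 := by exact_mod_cast (S.w_pos x).ne'
    simp only [wInv]
    push_cast
    field_simp
  refine ⟨q.conjExponent, fun x => S.w x * starRingEnd ℂ (Φ x), hc.symm.lt, ?_, fun v => ?_⟩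
  · unfold MemLw
    rw [hwI]
    exact MemLp.star hΦ
  · have h1 := hrep _ (v.2 q hq)
    have h2 : starRingEnd ℂ (T v) = ∫ x, Φ x * (S.w x * S.voice v.1 x) ∂μ := by
      rw [← h1]; exact (hΛA v).symm
    rw [← starRingEnd_self_apply (T v), h2, ← integral_conj]
    refine integral_congr_ae (Eventually.of_forall fun x => ?_)
    simp only [map_mul, Complex.conj_ofReal]
    ring

/-- The structure of distributions: the extended voice transform is reproduced by `K`, and it
determines the distribution. -/
lemma distribution_eq_integral (T : S.Distribution) :
    (∃ (a : ℝ) (Φ : G → ℂ), 1 < a ∧ MemLw μ S.wInv a Φ ∧ S.extVoice T = conv μ Φ S.K) ∧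
      ∀ v : S.TestSpace, T v = ∫ x, S.extVoice T x * starRingEnd ℂ (S.voice v.1 x) ∂μ := by
  obtain ⟨a, Φ, ha, hΦ, hT⟩ := S.exists_density_distribution T
  have h1 : S.extVoice T = conv μ Φ S.K := by
    ext x
    rw [extVoice, hT]
    simp_rw [conv, K_inv_mul]
    rfl
  refine ⟨⟨a, Φ, ha, hΦ, h1⟩, fun v => ?_⟩
  -- Fubini moves the kernel from $\Phi*K$ onto $\overline{Vv}$, which it reproduces; what remains
  -- is the density formula for $T$.
  rw [h1, S.integral_conv_K_mul ha hΦ (memLw_conj (v.2 _ (one_lt_exponent ha))), hT]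
  simp_rw [integral_K_mul_conj_voice]

lemma extVoice_injective {T T' : S.Distribution} (h : S.extVoice T = S.extVoice T') : T = T' := by
  ext v
  rw [(S.distribution_eq_integral T).2, (S.distribution_eq_integral T').2, h]

lemma conv_extVoice (T : S.Distribution) (x : G) :
    conv μ (S.extVoice T) S.K x = S.extVoice T x := by
  obtain ⟨a, Φ, ha, hΦ, h⟩ := (S.distribution_eq_integral T).1
  rw [h, S.conv_conv_K ha hΦ]

lemma extVoice_add (T T' : S.Distribution) :
    S.extVoice (T + T') = S.extVoice T + S.extVoice T' := by
  ext x; simp [extVoice]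

lemma extVoice_smul (c : ℂ) (T : S.Distribution) : S.extVoice (c • T) = c • S.extVoice T := by
  ext x; simp [extVoice]

/-- Functions in `L_{a,1/w}` define distributions. -/
lemma exists_distribution {a : ℝ} (ha : 1 < a) {f : G → ℂ} (hf : MemLw μ S.wInv a f) :
    ∃ T : S.Distribution, S.extVoice T = conv μ f S.K := by
  have hc := Real.HolderConjugate.conjExponent ha
  have hfm := S.aestronglyMeasurable_of_memLw_wInv hf
  have hle : ∀ v : S.TestSpace, ∫⁻ x, ‖f x * starRingEnd ℂ (S.voice v.1 x)‖ₑ ∂μ ≤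
      normLw μ S.wInv a f * normLw μ S.w a.conjExponent (S.voice v.1) := fun v => by
    refine (lintegral_enorm_mul_le S.w_pos hc hf (memLw_conj (v.2 _ hc.symm.lt))).trans
      (mul_le_mul' le_rfl (normLw_mono fun x => by simp))
  have hI : ∀ v : S.TestSpace, Integrable (fun x => f x * starRingEnd ℂ (S.voice v.1 x)) μ :=
    fun v => ⟨hfm.mul (Complex.continuous_conj.comp (S.voice_continuous _)).aestronglyMeasurable,
      lt_of_le_of_lt (hle v) (ENNReal.mul_lt_top hf.2 (v.2 _ hc.symm.lt).2)⟩
  let L : S.TestSpace →ₛₗ[starRingEnd ℂ] ℂ :=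
    { toFun := fun v => ∫ x, f x * starRingEnd ℂ (S.voice v.1 x) ∂μ
      map_add' := fun v v' => by
        rw [← integral_add (hI v) (hI v')]
        refine integral_congr_ae (Eventually.of_forall fun x => ?_)
        have : S.voice (v + v').1 x = S.voice v.1 x + S.voice v'.1 x :=
          congrFun (S.voice_add v.1 v'.1) x
        simp only [this, map_add, mul_add]
      map_smul' := fun c v => by
        rw [smul_eq_mul, ← integral_const_mul]
        refine integral_congr_ae (Eventually.of_forall fun x => ?_)
        have : S.voice (c • v).1 x = c • S.voice v.1 x := congrFun (S.voice_smul c v.1) x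
        simp only [this, smul_eq_mul, map_mul]
        ring }
  have hL : Continuous L := by
    refine S.testSpace_withSeminorms.continuous_normedSpace_rng ℂ L
      ⟨{⟨a.conjExponent, hc.symm.lt⟩}, (normLw μ S.wInv a f).toNNReal, fun v => ?_⟩
    rw [Finset.sup_singleton]
    have h1 := (enorm_integral_le_lintegral_enorm
      (fun x => f x * starRingEnd ℂ (S.voice v.1 x)) (μ := μ)).trans (hle v)
    have h2 := ENNReal.toReal_mono (ENNReal.mul_ne_top hf.2.ne (v.2 _ hc.symm.lt).2.ne) h1
    rw [toReal_enorm, ENNReal.toReal_mul] at h2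
    exact h2
  refine ⟨⟨L, hL⟩, ?_⟩
  ext x
  simp_rw [conv, K_inv_mul]
  rfl

end Distributions

end Setting

end Coorbit

namespace Coorbit

/-! ### Weighted sequence spaces -/

section SequenceSpace

variable {I : Type*}

/-- The `r`-th power of the norm of `ℓ_{r,v}(I)`, as an extended nonnegative number. -/
noncomputable def seqSum (v : I → ℝ) (r : ℝ) (c : I → ℂ) : ℝ≥0∞ := ∑' i, ‖(v i : ℂ) * c i‖ₑ ^ r

lemma seqSum_ne_top_iff (v : I → ℝ) {r : ℝ} (hr : 0 < r) (c : I → ℂ) :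
    seqSum v r c ≠ ∞ ↔ c ∈ seqSpace v r := by
  change _ ↔ Memℓp (fun i => (v i : ℂ) * c i) (ENNReal.ofReal r)
  rw [memℓp_gen_iff (by rwa [ENNReal.toReal_ofReal hr.le]), ENNReal.toReal_ofReal hr.le, seqSum]
  have e : ∀ i, ‖(v i : ℂ) * c i‖ₑ ^ r = ((‖(v i : ℂ) * c i‖₊ ^ r : ℝ≥0) : ℝ≥0∞) := fun i => by
    rw [ENNReal.coe_rpow_of_nonneg _ hr.le]; rfl
  simp_rw [e]
  rw [ENNReal.tsum_coe_ne_top_iff_summable, ← NNReal.summable_coe]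
  simp

lemma seqNorm_eq (v : I → ℝ) (hv : ∀ i, 0 ≤ v i) {r : ℝ} (hr : 0 < r) (c : I → ℂ) :
    seqNorm v r c = (seqSum v r c ^ (1 / r)).toReal := by
  rw [seqNorm, ← ENNReal.toReal_rpow, seqSum, ENNReal.tsum_toReal_eq]
  · congr 1
    refine tsum_congr fun i => ?_
    rw [← ENNReal.toReal_rpow, toReal_enorm, norm_mul, Complex.norm_real,
      Real.norm_of_nonneg (hv i)]
  · intro i
    exact ENNReal.rpow_ne_top_of_nonneg hr.le enorm_ne_top

end SequenceSpace

section Synthesis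

variable {G : Type*} {I : Type*}

/-- The synthesis map `c ↦ ∑ c_i ψ_i`. -/
noncomputable def synth (ψ : I → G → ℝ) (c : I → ℂ) (x : G) : ℂ := ∑' i, c i * ψ i x

end Synthesis

/-! ### Partitions of unity and step functions -/

section Bupu

variable {G : Type*} [TopologicalSpace G] [Group G] [IsTopologicalGroup G]
  [MeasurableSpace G] {I : Type*} {U : Set G} {X : I → G} {ψ : I → G → ℝ}

lemma IsBUPU.finite_support (h : IsBUPU U X ψ) (hU : IsCompact U) (hU1 : U ∈ 𝓝 (1 : G)) (x : G) :
    {i | x ∈ X i • U}.Finite := by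
  obtain ⟨N, hN⟩ := h.separated U hU hU1
  exact Set.finite_of_encard_le_coe (hN x)

/-- Each translate of the interior of $U$ contains a point of a countable dense set, and each such
point lies in only finitely many translates. -/
lemma IsBUPU.countable [SecondCountableTopology G] (h : IsBUPU U X ψ) (hU : IsCompact U)
    (hU1 : U ∈ 𝓝 (1 : G)) : Countable I := by
  have hne : Nonempty G := ⟨1⟩
  obtain ⟨d, hd⟩ := TopologicalSpace.exists_dense_seq G
  rw [← Set.countable_univ_iff]
  refine (Set.countable_iUnion fun k => (h.finite_support hU hU1 (d k)).countable).mono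
    fun i _ => ?_
  have ho : IsOpen (X i • interior U) := isOpen_interior.smul _
  have hn : (X i • interior U).Nonempty :=
    ⟨X i • 1, Set.smul_mem_smul_set (mem_interior_iff_mem_nhds.2 hU1)⟩
  obtain ⟨_, hy, k, rfl⟩ := hd.inter_open_nonempty _ ho hn
  exact Set.mem_iUnion.2 ⟨k, Set.smul_set_mono interior_subset hy⟩

lemma IsBUPU.eq_zero_of_notMem (h : IsBUPU U X ψ) (hU : IsCompact U) (hU1 : U ∈ 𝓝 (1 : G)) (x : G)
    {i : I} (hi : i ∉ (h.finite_support hU hU1 x).toFinset) : ψ i x = 0 := by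
  apply h.support
  simpa using hi

lemma IsBUPU.synth_eq_sum (h : IsBUPU U X ψ) (hU : IsCompact U) (hU1 : U ∈ 𝓝 (1 : G)) (c : I → ℂ)
    (x : G) : synth ψ c x = ∑ i ∈ (h.finite_support hU hU1 x).toFinset, c i * ψ i x :=
  tsum_eq_sum fun i hi => by rw [h.eq_zero_of_notMem hU hU1 x hi]; simp

lemma IsBUPU.sum_eq (h : IsBUPU U X ψ) (hU : IsCompact U) (hU1 : U ∈ 𝓝 (1 : G)) (x : G) :
    ∑ i ∈ (h.finite_support hU hU1 x).toFinset, ψ i x = 1 := by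
  rw [← (h.sum_eq_one x).tsum_eq]
  exact (tsum_eq_sum fun i hi => h.eq_zero_of_notMem hU hU1 x hi).symm

lemma IsBUPU.sum_ofReal_eq (h : IsBUPU U X ψ) (hU : IsCompact U) (hU1 : U ∈ 𝓝 (1 : G)) (x : G) :
    ∑ i ∈ (h.finite_support hU hU1 x).toFinset, ENNReal.ofReal (ψ i x) = 1 := by
  rw [← ENNReal.ofReal_sum_of_nonneg fun i _ => (h.mem_Icc i x).1, h.sum_eq hU hU1]
  simp

lemma IsBUPU.enorm_psi (h : IsBUPU U X ψ) (i : I) (x : G) :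
    ‖(ψ i x : ℂ)‖ₑ = ENNReal.ofReal (ψ i x) := by
  rw [← ofReal_norm, Complex.norm_of_nonneg (h.mem_Icc i x).1]

lemma IsBUPU.synth_add (h : IsBUPU U X ψ) (hU : IsCompact U) (hU1 : U ∈ 𝓝 (1 : G))
    (c c' : I → ℂ) : synth ψ (c + c') = synth ψ c + synth ψ c' := by
  ext x
  simp [h.synth_eq_sum hU hU1, add_mul, Finset.sum_add_distrib]

lemma IsBUPU.synth_smul (h : IsBUPU U X ψ) (hU : IsCompact U) (hU1 : U ∈ 𝓝 (1 : G))
    (a : ℂ) (c : I → ℂ) : synth ψ (a • c) = a • synth ψ c := by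
  ext x
  simp [h.synth_eq_sum hU hU1, mul_assoc, Finset.mul_sum]

lemma IsBUPU.measurable_synth [SecondCountableTopology G] (h : IsBUPU U X ψ) (hU : IsCompact U)
    (hU1 : U ∈ 𝓝 (1 : G)) (c : I → ℂ) : Measurable (synth ψ c) := by
  have := h.countable hU hU1
  exact Measurable.tsum fun i =>
    measurable_const.mul (Complex.measurable_ofReal.comp (h.measurable i))

/-- The error of the step function approximation is dominated by the oscillation. -/
lemma IsBUPU.enorm_sub_synth_le (h : IsBUPU U X ψ) (hU : IsCompact U) (hU1 : U ∈ 𝓝 (1 : G))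
    (f : G → ℂ) (x : G) : ‖(f - synth ψ (f ∘ X)) x‖ₑ ≤ oscRight U⁻¹ f x := by
  set s := (h.finite_support hU hU1 x).toFinset with hs
  have e : (f - synth ψ (f ∘ X)) x = ∑ i ∈ s, (f x - f (X i)) * ψ i x := by
    simp only [sub_mul, Finset.sum_sub_distrib]
    rw [← Finset.mul_sum, ← Complex.ofReal_sum, h.sum_eq hU hU1, Pi.sub_apply,
      h.synth_eq_sum hU hU1]
    simp [hs]
  rw [e]
  refine (enorm_sum_le _ _).trans ?_
  calc ∑ i ∈ s, ‖(f x - f (X i)) * ψ i x‖ₑ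
      ≤ ∑ i ∈ s, oscRight U⁻¹ f x * ENNReal.ofReal (ψ i x) := by
        refine Finset.sum_le_sum fun i hi => ?_
        rw [enorm_mul, h.enorm_psi]
        gcongr
        rw [hs, Set.Finite.mem_toFinset] at hi
        obtain ⟨u, hu, hux⟩ := hi
        have hx : x * u⁻¹ = X i := by rw [← hux]; simp
        rw [← hx, enorm_sub_rev]
        exact le_iSup₂ (f := fun u (_ : u ∈ U⁻¹) => ‖f (x * u) - f x‖ₑ) u⁻¹
          (Set.inv_mem_inv.2 hu)
    _ = oscRight U⁻¹ f x := by rw [← Finset.mul_sum, h.sum_ofReal_eq hU hU1, mul_one]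

lemma IsBUPU.normLw_sub_synth_le (h : IsBUPU U X ψ) (hU : IsCompact U) (hU1 : U ∈ 𝓝 (1 : G))
    (μ : Measure G) {m : G → ℝ} (hm : ∀ x, 0 < m x) (r : ℝ) (f : G → ℂ) :
    normLw μ m r (f - synth ψ (f ∘ X)) ≤ normLwENN μ m r (oscRight U⁻¹ f) := by
  refine eLpNorm_mono_enorm fun x => ?_
  rw [enorm_eq_self, enorm_mul, ← ofReal_norm, Complex.norm_of_nonneg (hm x).le]
  gcongr
  exact h.enorm_sub_synth_le hU hU1 f x

end Bupu

/-! ### Norm estimates for synthesis and sampling -/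

section Bounds

variable {G : Type*} [TopologicalSpace G] [Group G] [IsTopologicalGroup G]
  [SecondCountableTopology G] [MeasurableSpace G] [BorelSpace G] {μ : Measure G} [μ.IsHaarMeasure]
  {I : Type*} {U : Set G} {X : I → G} {ψ : I → G → ℝ} {w m : G → ℝ}

lemma exists_bound_on_compact (hw : IsControlWeight w) (hU : IsCompact U) :
    ∃ B : ℝ≥0, ∀ u ∈ U, w u ≤ B := by
  obtain ⟨B, hB⟩ := hU.bddAbove_image hw.continuous.continuousOn
  exact ⟨B.toNNReal, fun u hu => (hB (Set.mem_image_of_mem _ hu)).trans (Real.le_coe_toNNReal B)⟩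

/-- The synthesis map is bounded from `ℓ_{r,m_X}` to `L_{r,m}`. -/
lemma IsBUPU.exists_normLw_synth_le (h : IsBUPU U X ψ) (hU : IsCompact U) (hU1 : U ∈ 𝓝 (1 : G))
    (hw : IsControlWeight w) (hm : IsModerate w m) {r : ℝ} (hr : 1 < r) :
    ∃ D : ℝ≥0, ∀ c : I → ℂ,
      normLw μ m r (synth ψ c) ≤ D * seqSum (m ∘ X) r c ^ (1 / r) := by
  obtain ⟨B, hB⟩ := exists_bound_on_compact hw hU
  have r0 : 0 < r := by linarith
  have hμU : μ U ≠ ∞ := hU.measure_lt_top.ne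
  have := h.countable hU hU1
  refine ⟨((B : ℝ≥0∞) * μ U ^ (1 / r)).toNNReal, fun c => ?_⟩
  rw [ENNReal.coe_toNNReal (ENNReal.mul_ne_top ENNReal.coe_ne_top
    (ENNReal.rpow_ne_top_of_nonneg (by positivity) hμU))]
  have hpt : ∀ x, ‖(m x : ℂ) * synth ψ c x‖ₑ ^ r ≤
      ∑' i, ENNReal.ofReal (ψ i x) * ((B : ℝ≥0∞) ^ r * ‖((m ∘ X) i : ℂ) * c i‖ₑ ^ r) := by
    intro x
    set s := (h.finite_support hU hU1 x).toFinset with hs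
    rw [h.synth_eq_sum hU hU1, Finset.mul_sum]
    have h1 : ‖∑ i ∈ s, (m x : ℂ) * (c i * ψ i x)‖ₑ ≤
        ∑ i ∈ s, ENNReal.ofReal (ψ i x) * (B * ‖((m ∘ X) i : ℂ) * c i‖ₑ) := by
      refine (enorm_sum_le _ _).trans (Finset.sum_le_sum fun i hi => ?_)
      rw [hs, Set.Finite.mem_toFinset] at hi
      obtain ⟨u, hu, hux⟩ := hi
      have hmx : ‖(m x : ℂ)‖ₑ ≤ B * ‖((m ∘ X) i : ℂ)‖ₑ := by
        rw [← ofReal_norm, ← ofReal_norm, Complex.norm_of_nonneg (hm.pos _).le,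
          Function.comp_apply, Complex.norm_of_nonneg (hm.pos _).le,
          ← ENNReal.ofReal_coe_nnreal (p := B), ← ENNReal.ofReal_mul (by positivity)]
        apply ENNReal.ofReal_le_ofReal
        have h2 := hm.right (X i) u
        have h3 : X i * u = x := hux
        rw [h3] at h2
        rw [mul_comm]
        exact h2.trans (mul_le_mul_of_nonneg_left (hB u hu) (hm.pos _).le)
      rw [enorm_mul, enorm_mul, h.enorm_psi, enorm_mul]
      calc _ = ENNReal.ofReal (ψ i x) * (‖(m x : ℂ)‖ₑ * ‖c i‖ₑ) := by ring
        _ ≤ ENNReal.ofReal (ψ i x) * (B * ‖((m ∘ X) i : ℂ)‖ₑ * ‖c i‖ₑ) := by gcongr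
        _ = _ := by ring
    refine (ENNReal.rpow_le_rpow h1 r0.le).trans ?_
    -- The numbers $\psi_i(x)$ are convex weights, so Jensen's inequality moves the power $r$ inside
    -- the sum.
    refine (ENNReal.rpow_arith_mean_le_arith_mean_rpow s _ _ (h.sum_ofReal_eq hU hU1 x)
      hr.le).trans ?_
    simp_rw [ENNReal.mul_rpow_of_nonneg _ _ r0.le]
    exact ENNReal.sum_le_tsum s
  have hψ : ∀ i, ∫⁻ x, ENNReal.ofReal (ψ i x) ∂μ ≤ μ U := by
    intro i
    rw [← measure_smul μ (X i) U]
    refine le_trans (lintegral_mono fun x => ?_) (lintegral_indicator_one_le (X i • U))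
    by_cases hx : x ∈ X i • U
    · simpa [hx] using (h.mem_Icc i x).2
    · simp [h.support i x hx]
  have hint : ∫⁻ x, ‖(m x : ℂ) * synth ψ c x‖ₑ ^ r ∂μ ≤
      (B : ℝ≥0∞) ^ r * μ U * seqSum (m ∘ X) r c := by
    refine (lintegral_mono hpt).trans ?_
    rw [lintegral_tsum fun i => ((h.measurable i).ennreal_ofReal.mul_const _).aemeasurable,
      seqSum, ← ENNReal.tsum_mul_left]
    refine ENNReal.tsum_le_tsum fun i => ?_
    rw [lintegral_mul_const _ (h.measurable i).ennreal_ofReal]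
    calc _ ≤ μ U * ((B : ℝ≥0∞) ^ r * ‖((m ∘ X) i : ℂ) * c i‖ₑ ^ r) := by gcongr; exact hψ i
      _ = _ := by ring
  rw [normLw_eq_lintegral r0]
  refine (ENNReal.rpow_le_rpow hint (by positivity : 0 ≤ 1 / r)).trans (le_of_eq ?_)
  have r1 : 0 ≤ 1 / r := by positivity
  rw [ENNReal.mul_rpow_of_nonneg _ _ r1, ENNReal.mul_rpow_of_nonneg _ _ r1, ← ENNReal.rpow_mul,
    mul_one_div_cancel r0.ne', ENNReal.rpow_one]

/-- Samples of `f` are controlled by `f` and its oscillation. -/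
lemma IsBUPU.exists_seqSum_le (h : IsBUPU U X ψ) (hU : IsCompact U) (hU1 : U ∈ 𝓝 (1 : G))
    (hw : IsControlWeight w) (hm : IsModerate w m) {r : ℝ} (hr : 1 < r) :
    ∃ D : ℝ≥0, ∀ f : G → ℂ, MemLw μ m r f →
      seqSum (m ∘ X) r (f ∘ X) ≤
        D * (normLw μ m r f ^ r + normLwENN μ m r (oscRight U⁻¹ f) ^ r) := by
  obtain ⟨B, hB⟩ := exists_bound_on_compact hw hU
  obtain ⟨N, hN⟩ := h.separated U hU hU1
  have r0 : 0 < r := by linarith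
  have := h.countable hU hU1
  -- The interior is measurable without a Hausdorff assumption, and has positive finite measure; the
  -- samples are averaged over its translates.
  set V := interior U with hV
  have hV0 : μ V ≠ 0 :=
    (isOpen_interior.measure_pos μ ⟨1, mem_interior_iff_mem_nhds.2 hU1⟩).ne'
  have hVt : μ V ≠ ∞ := ne_top_of_le_ne_top hU.measure_lt_top.ne (measure_mono interior_subset)
  set D : ℝ≥0∞ := (μ V)⁻¹ * (N * ((B : ℝ≥0∞) ^ r * 2 ^ (r - 1))) with hD
  have hDt : D ≠ ∞ := by
    refine ENNReal.mul_ne_top (ENNReal.inv_ne_top.2 hV0) (ENNReal.mul_ne_top (by simp)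
      (ENNReal.mul_ne_top (ENNReal.rpow_ne_top_of_nonneg r0.le (by simp))
        (ENNReal.rpow_ne_top_of_nonneg (by linarith) (by simp))))
  refine ⟨D.toNNReal, fun f hf => ?_⟩
  rw [ENNReal.coe_toNNReal hDt]
  set a : I → ℝ≥0∞ := fun i => ‖((m ∘ X) i : ℂ) * (f ∘ X) i‖ₑ with ha
  let P : G → ℝ≥0∞ := fun x => ‖(m x : ℂ) * f x‖ₑ ^ r
  let O : G → ℝ≥0∞ := fun x => (ENNReal.ofReal (m x) * oscRight U⁻¹ f x) ^ r
  have hai : ∀ i x, x ∈ X i • U → a i ^ r ≤ (B : ℝ≥0∞) ^ r * 2 ^ (r - 1) * (P x + O x) := by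
    rintro i x ⟨u, hu, hux⟩
    have hx : x * u⁻¹ = X i := by rw [← hux]; simp
    have h1 : a i ≤ B * (‖(m x : ℂ) * f x‖ₑ + ENNReal.ofReal (m x) * oscRight U⁻¹ f x) := by
      have h2 : ‖f (X i)‖ₑ ≤ ‖f x‖ₑ + oscRight U⁻¹ f x := by
        have h3 : f (X i) = f x + (f (x * u⁻¹) - f x) := by rw [hx]; ring
        rw [h3]
        refine (enorm_add_le _ _).trans ?_
        gcongr
        exact le_iSup₂ (f := fun u (_ : u ∈ U⁻¹) => ‖f (x * u) - f x‖ₑ) u⁻¹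
          (Set.inv_mem_inv.2 hu)
      have h4 : ‖(m (X i) : ℂ)‖ₑ ≤ B * ENNReal.ofReal (m x) := by
        rw [← ofReal_norm, Complex.norm_of_nonneg (hm.pos _).le,
          ← ENNReal.ofReal_coe_nnreal (p := B), ← ENNReal.ofReal_mul (by positivity)]
        apply ENNReal.ofReal_le_ofReal
        have h5 := hm.right x u⁻¹
        rw [hx, hw.symm] at h5
        rw [mul_comm]
        exact h5.trans (mul_le_mul_of_nonneg_left (hB u hu) (hm.pos _).le)
      simp only [ha, Function.comp_apply, enorm_mul]
      rw [← ofReal_norm (m x : ℂ), Complex.norm_of_nonneg (hm.pos _).le]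
      calc _ ≤ B * ENNReal.ofReal (m x) * (‖f x‖ₑ + oscRight U⁻¹ f x) := by gcongr
        _ = _ := by ring
    refine (ENNReal.rpow_le_rpow h1 r0.le).trans ?_
    rw [ENNReal.mul_rpow_of_nonneg _ _ r0.le, mul_assoc]
    gcongr
    exact ENNReal.rpow_add_le_mul_rpow_add_rpow _ _ hr.le
  have hVm : ∀ i, MeasurableSet (X i • V) := fun i => (isOpen_interior.smul (X i)).measurableSet
  have h1 : μ V * seqSum (m ∘ X) r (f ∘ X)
      = ∫⁻ x, ∑' i, (X i • V).indicator (fun _ => a i ^ r) x ∂μ := by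
    rw [lintegral_tsum fun i => (measurable_const.indicator (hVm i)).aemeasurable, seqSum,
      ← ENNReal.tsum_mul_left]
    refine tsum_congr fun i => ?_
    rw [lintegral_indicator (hVm i), setLIntegral_const, measure_smul, mul_comm]
  have h2 : ∀ x, ∑' i, (X i • V).indicator (fun _ => a i ^ r) x ≤
      N * ((B : ℝ≥0∞) ^ r * 2 ^ (r - 1) * (P x + O x)) := by
    intro x
    set s := (h.finite_support hU hU1 x).toFinset with hs
    rw [tsum_eq_sum (s := s)]
    · have hcard : (s.card : ℝ≥0∞) ≤ N := by
        have h3 := hN x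
        rw [(h.finite_support hU hU1 x).encard_eq_coe_toFinset_card] at h3
        exact_mod_cast h3
      refine (Finset.sum_le_card_nsmul s _ ((B : ℝ≥0∞) ^ r * 2 ^ (r - 1) * (P x + O x)) ?_).trans ?_
      · intro i hi
        rw [hs, Set.Finite.mem_toFinset] at hi
        exact (Set.indicator_le_self _ _ _).trans (hai i x hi)
      · rw [nsmul_eq_mul]; gcongr
    · intro i hi
      rw [Set.indicator_of_notMem]
      intro hx
      apply hi
      rw [hs, Set.Finite.mem_toFinset]
      exact Set.smul_set_mono interior_subset hx
  have hP : AEMeasurable P μ := hf.1.enorm.pow_const _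
  -- Only `P` has to be measurable here: the oscillation is an uncountable supremum and may fail to
  -- be.
  have h3 : ∫⁻ x, P x + O x ∂μ
      = normLw μ m r f ^ r + normLwENN μ m r (oscRight U⁻¹ f) ^ r := by
    rw [lintegral_add_left' hP, normLw_rpow r0, normLwENN,
      eLpNorm_eq_lintegral_rpow_enorm_toReal (by simpa using r0) ENNReal.ofReal_ne_top,
      ENNReal.toReal_ofReal r0.le, ← ENNReal.rpow_mul, one_div_mul_cancel r0.ne', ENNReal.rpow_one]
    simp only [enorm_eq_self, P, O]
  have h4 : μ V * seqSum (m ∘ X) r (f ∘ X) ≤ N * ((B : ℝ≥0∞) ^ r * 2 ^ (r - 1)) *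
      (normLw μ m r f ^ r + normLwENN μ m r (oscRight U⁻¹ f) ^ r) := by
    rw [h1, ← h3, ← lintegral_const_mul']
    · refine lintegral_mono fun x => (h2 x).trans (le_of_eq (by ring))
    · exact ENNReal.mul_ne_top (by simp)
        (ENNReal.mul_ne_top (ENNReal.rpow_ne_top_of_nonneg r0.le (by simp))
          (ENNReal.rpow_ne_top_of_nonneg (by linarith) (by simp)))
  rw [hD, mul_assoc]
  calc seqSum (m ∘ X) r (f ∘ X) = (μ V)⁻¹ * (μ V * seqSum (m ∘ X) r (f ∘ X)) := by
        rw [← mul_assoc, ENNReal.inv_mul_cancel hV0 hVt, one_mul]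
    _ ≤ _ := by gcongr

end Bounds

end Coorbit

/-! ### Reconstruction by a Neumann series -/

namespace Coorbit

namespace Setting

variable {G : Type*} [TopologicalSpace G] [Group G] [IsTopologicalGroup G] [LocallyCompactSpace G]
  [SecondCountableTopology G] [MeasurableSpace G] [BorelSpace G]
  {μ : Measure G} [μ.IsHaarMeasure]
  {H : Type*} [NormedAddCommGroup H] [InnerProductSpace ℂ H] (S : Setting μ H)
  {I : Type*}

/-- The error `f - (∑ f(x_i) ψ_i) * K` of one step of the reconstruction algorithm. -/
noncomputable def residual (X : I → G) (ψ : I → G → ℝ) (f : G → ℂ) : G → ℂ :=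
  f - conv μ (synth ψ (f ∘ X)) S.K

/-- The partial sums of the Neumann series of the reconstruction. -/
noncomputable def neumannSum (X : I → G) (ψ : I → G → ℝ) (g : G → ℂ) (n : ℕ) : G → ℂ :=
  ∑ k ∈ Finset.range n, (S.residual X ψ)^[k] g

/-- `T` is the distribution reconstructed from the coefficients `c` by the Neumann series. -/
def IsReconstruction (X : I → G) (ψ : I → G → ℝ) (c : I → ℂ) (T : S.Distribution) : Prop :=
  ∀ x, Tendsto (fun n => S.neumannSum X ψ (conv μ (synth ψ c) S.K) n x) atTop (𝓝 (S.extVoice T x))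

open Classical in
/-- The reconstruction operator: it depends on the points and the partition of unity only. -/
noncomputable def reconstruct (X : I → G) (ψ : I → G → ℝ) (c : I → ℂ) : S.Distribution :=
  if h : ∃ T, S.IsReconstruction X ψ c T then h.choose else 0

variable {S} in
lemma IsReconstruction.reconstruct_eq {X : I → G} {ψ : I → G → ℝ} {c : I → ℂ}
    {T : S.Distribution} (hT : S.IsReconstruction X ψ c T) : S.reconstruct X ψ c = T := by
  have h : ∃ T, S.IsReconstruction X ψ c T := ⟨T, hT⟩
  rw [reconstruct, dif_pos h]
  refine S.extVoice_injective ?_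
  ext x
  exact tendsto_nhds_unique (h.choose_spec x) (hT x)

/-- Hypotheses under which the Neumann series of the reconstruction converges in `L_{r,m}`. -/
structure NeumannHypotheses (r : ℝ) (m : G → ℝ) (U : Set G) (X : I → G) (ψ : I → G → ℝ)
    (c : ℝ≥0) : Prop where
  one_lt : 1 < r
  moderate : IsModerate S.w m
  rightConv : RightConvWellDefined μ m r S.K
  compact : IsCompact U
  nhds : U ∈ 𝓝 (1 : G)
  bupu : IsBUPU U X ψ
  osc_le : ∀ f : G → ℂ, MemRKS μ m r S.K f →
    normLwENN μ m r (oscRight U⁻¹ f) ≤ c * normLw μ m r f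
  lt_one : rightConvNorm μ m r S.K * c < 1

namespace NeumannHypotheses

variable {S} {r : ℝ} {m : G → ℝ} {U : Set G} {X : I → G} {ψ : I → G → ℝ} {c : ℝ≥0}
  (h : S.NeumannHypotheses r m U X ψ c)

include h

lemma conv_memRKS {f : G → ℂ} (hf : MemLw μ m r f) : MemRKS μ m r S.K (conv μ f S.K) :=
  ⟨(h.rightConv f hf).2, S.conv_conv_K h.one_lt (S.memLw_wInv h.moderate hf)⟩

lemma conv_add {f g : G → ℂ} (hf : MemLw μ m r f) (hg : MemLw μ m r g) :
    conv μ (f + g) S.K = conv μ f S.K + conv μ g S.K :=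
  S.conv_K_add h.one_lt (S.memLw_wInv h.moderate hf) (S.memLw_wInv h.moderate hg)

lemma conv_sub {f g : G → ℂ} (hf : MemLw μ m r f) (hg : MemLw μ m r g) :
    conv μ (f - g) S.K = conv μ f S.K - conv μ g S.K :=
  S.conv_K_sub h.one_lt (S.memLw_wInv h.moderate hf) (S.memLw_wInv h.moderate hg)

/-- The oscillation bound alone suffices. Membership of the step function itself follows by
subtraction, without the sampling inequality. -/
lemma memLw_sub_synth {f : G → ℂ} (hf : MemRKS μ m r S.K f) :
    MemLw μ m r (f - synth ψ (f ∘ X)) := by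
  refine ⟨?_, ?_⟩
  · exact (Complex.continuous_ofReal.comp h.moderate.continuous).aestronglyMeasurable.mul
      ((aestronglyMeasurable_of_memLw h.moderate.continuous h.moderate.pos hf.1).sub
        (h.bupu.measurable_synth h.compact h.nhds _).aestronglyMeasurable)
  · exact lt_of_le_of_lt ((h.bupu.normLw_sub_synth_le h.compact h.nhds μ h.moderate.pos r f).trans
      (h.osc_le f hf)) (ENNReal.mul_lt_top ENNReal.coe_lt_top hf.1.2)

lemma memLw_synth {f : G → ℂ} (hf : MemRKS μ m r S.K f) : MemLw μ m r (synth ψ (f ∘ X)) := by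
  have := hf.1.sub (h.memLw_sub_synth hf)
  rwa [sub_sub_cancel] at this

/-- Writing $f=f*K$ puts the whole error under one convolution, where the small difference $f-\sum_i
f(x_i)\psi_i$ is seen. The contraction estimate rests on this form. -/
lemma residual_eq {f : G → ℂ} (hf : MemRKS μ m r S.K f) :
    S.residual X ψ f = conv μ (f - synth ψ (f ∘ X)) S.K := by
  rw [h.conv_sub hf.1 (h.memLw_synth hf), residual, funext hf.2]

lemma residual_mem {f : G → ℂ} (hf : MemRKS μ m r S.K f) :
    MemRKS μ m r S.K (S.residual X ψ f) := by
  rw [h.residual_eq hf]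
  exact h.conv_memRKS (h.memLw_sub_synth hf)

lemma normLw_residual_le {f : G → ℂ} (hf : MemRKS μ m r S.K f) :
    normLw μ m r (S.residual X ψ f) ≤ rightConvNorm μ m r S.K * c * normLw μ m r f := by
  rw [h.residual_eq hf, mul_assoc]
  refine (S.normLw_conv_K_le h.moderate h.one_lt h.rightConv (h.memLw_sub_synth hf)).trans ?_
  gcongr
  exact (h.bupu.normLw_sub_synth_le h.compact h.nhds μ h.moderate.pos r f).trans (h.osc_le f hf)

/-- The reproducing kernel space as a subspace. -/
def rks : Submodule ℂ (G → ℂ) where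
  carrier := {f | MemRKS μ m r S.K f}
  zero_mem' := by
    refine ⟨?_, fun x => by simp [conv]⟩
    have : (fun x => (m x : ℂ) * (0 : G → ℂ) x) = 0 := by ext x; simp
    unfold MemLw
    rw [this]; exact MemLp.zero
  add_mem' := fun {f g} hf hg => ⟨hf.1.add hg.1, fun x => by
    rw [h.conv_add hf.1 hg.1, Pi.add_apply, hf.2, hg.2, Pi.add_apply]⟩
  smul_mem' := fun a f hf => ⟨hf.1.const_smul a, fun x => by
    rw [S.conv_K_smul, Pi.smul_apply, hf.2, Pi.smul_apply]⟩

lemma residual_add {f g : G → ℂ} (hf : MemRKS μ m r S.K f) (hg : MemRKS μ m r S.K g) :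
    S.residual X ψ (f + g) = S.residual X ψ f + S.residual X ψ g := by
  have e : (f + g) ∘ X = f ∘ X + g ∘ X := rfl
  simp only [residual]
  rw [e, h.bupu.synth_add h.compact h.nhds, h.conv_add (h.memLw_synth hf) (h.memLw_synth hg)]
  abel

lemma residual_smul (a : ℂ) (f : G → ℂ) :
    S.residual X ψ (a • f) = a • S.residual X ψ f := by
  have e : (a • f) ∘ X = a • (f ∘ X) := rfl
  simp only [residual]
  rw [e, h.bupu.synth_smul h.compact h.nhds, S.conv_K_smul, smul_sub]

/-- The residual as an operator on the reproducing kernel space. -/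
noncomputable def residualMap : h.rks →ₗ[ℂ] h.rks where
  toFun f := ⟨S.residual X ψ f.1, h.residual_mem f.2⟩
  map_add' f g := Subtype.ext (h.residual_add f.2 g.2)
  map_smul' a f := Subtype.ext (h.residual_smul a f.1)

lemma coe_residualMap_pow (f : h.rks) (n : ℕ) :
    (((h.residualMap ^ n) f : h.rks) : G → ℂ) = (S.residual X ψ)^[n] f.1 := by
  induction n with
  | zero => rfl
  | succ n ih =>
    rw [pow_succ', Function.iterate_succ_apply', ← ih]
    rfl

lemma coe_sum_residualMap_pow (f : h.rks) (n : ℕ) :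
    (((∑ k ∈ Finset.range n, h.residualMap ^ k) f : h.rks) : G → ℂ)
      = S.neumannSum X ψ f.1 n := by
  rw [LinearMap.sum_apply, Submodule.coe_sum, neumannSum]
  exact Finset.sum_congr rfl fun k _ => h.coe_residualMap_pow f k

lemma normLw_residualMap_pow_le (f : h.rks) (n : ℕ) :
    normLw μ m r (((h.residualMap ^ n) f : h.rks) : G → ℂ)
      ≤ (rightConvNorm μ m r S.K * c) ^ n * normLw μ m r f.1 := by
  induction n with
  | zero => simp
  | succ n ih =>
    rw [pow_succ' h.residualMap, pow_succ', mul_assoc]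
    exact (h.normLw_residual_le ((h.residualMap ^ n) f).2).trans (by gcongr)

lemma tendsto_residualMap_pow (f : h.rks) (x : G) :
    Tendsto (fun n => (((h.residualMap ^ n) f : h.rks) : G → ℂ) x) atTop (𝓝 0) := by
  have h1 : Tendsto (fun n => normLw μ m r ((((h.residualMap ^ n) f : h.rks) : G → ℂ) - 0)) atTop
      (𝓝 0) := by
    simp only [sub_zero]
    have h2 := ENNReal.Tendsto.mul_const (b := normLw μ m r f.1)
      (ENNReal.tendsto_pow_atTop_nhds_zero_iff.2 h.lt_one) (Or.inr f.2.1.2.ne)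
    rw [zero_mul] at h2
    exact tendsto_of_tendsto_of_tendsto_of_le_of_le tendsto_const_nhds h2 (fun n => zero_le)
      fun n => h.normLw_residualMap_pow_le f n
  have h3 := S.tendsto_conv_K_of_moderate h.moderate h.one_lt
    (fun n => ((h.residualMap ^ n) f).2.1) (h.rks.zero_mem.1) h1 x
  have h4 : conv μ (0 : G → ℂ) S.K x = 0 := by simp [conv]
  rw [h4] at h3
  exact h3.congr fun n => ((h.residualMap ^ n) f).2.2 x

/-- Convergence of the Neumann series. -/
lemma exists_limit : ∃ E : ℝ≥0, ∀ g : h.rks, ∃ f : h.rks,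
    normLw μ m r f.1 ≤ E * normLw μ m r g.1 ∧
    ∀ x, Tendsto (fun n => S.neumannSum X ψ g.1 n x) atTop (𝓝 (f.1 x)) := by
  have hfact : Fact (1 ≤ ENNReal.ofReal r) := ⟨by simpa using h.one_lt.le⟩
  set θ := rightConvNorm μ m r S.K * c with hθ
  have hθ1 : θ < 1 := h.lt_one
  have hθt : θ ≠ ∞ := hθ1.ne_top
  have hRt := S.rightConvNorm_ne_top h.moderate h.one_lt h.rightConv
  have hinv : (1 - θ)⁻¹ ≠ ∞ := ENNReal.inv_ne_top.2 (tsub_pos_of_lt hθ1).ne'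
  refine ⟨(rightConvNorm μ m r S.K * (1 - θ)⁻¹).toNNReal, fun g => ?_⟩
  rw [ENNReal.coe_toNNReal (ENNReal.mul_ne_top hRt hinv)]
  set N := normLw μ m r g.1 with hN
  have hNt : N ≠ ∞ := g.2.1.2.ne
  let u : ℕ → Lp ℂ (ENNReal.ofReal r) μ := fun k => ((h.residualMap ^ k) g).2.1.toLw
  have hu : ∀ k, ‖u k‖ₑ ≤ θ ^ k * N := fun k => by
    rw [MemLw.enorm_toLw]; exact h.normLw_residualMap_pow_le g k
  have hsum : Summable u := by
    refine Summable.of_norm_bounded (g := fun k => θ.toReal ^ k * N.toReal) ?_ fun k => ?_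
    · refine (summable_geometric_of_lt_one ENNReal.toReal_nonneg ?_).mul_right _
      simpa using (ENNReal.toReal_lt_toReal hθt ENNReal.one_ne_top).2 hθ1
    · have := ENNReal.toReal_mono (ENNReal.mul_ne_top (ENNReal.pow_ne_top hθt) hNt) (hu k)
      simpa using this
  let F := ∑' k, u k
  let f₀ : G → ℂ := fun x => F x / m x
  have hf₀ : MemLw μ m r f₀ := memLw_div_weight h.moderate.pos (Lp.memLp F)
  have hf₀F : hf₀.toLw = F := by
    apply Lp.ext
    filter_upwards [hf₀.coeFn_toLw] with x hx
    rw [hx]; exact mul_div_weight h.moderate.pos _ _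
  let P : ℕ → h.rks := fun n => (∑ k ∈ Finset.range n, h.residualMap ^ k) g
  have hP : ∀ n, (P n).2.1.toLw = ∑ k ∈ Finset.range n, u k := by
    intro n
    induction n with
    | zero =>
      rw [Finset.sum_range_zero, ← enorm_eq_zero, MemLw.enorm_toLw]
      simp [P, normLw]
    | succ n ih =>
      rw [Finset.sum_range_succ, ← ih]
      refine MemLw.toLw_eq_add _ _ _ ?_
      simp only [P, Finset.sum_range_succ, LinearMap.add_apply]
      rfl
  have hlim : Tendsto (fun n => normLw μ m r ((P n).1 - f₀)) atTop (𝓝 0) := by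
    have h1 := (tendsto_iff_edist_tendsto_0.1 hsum.hasSum.tendsto_sum_nat)
    refine h1.congr fun n => ?_
    have hPn : MemLw μ m r (P n).1 := (P n).2.1
    have h2 : hPn.toLw = (hPn.sub hf₀).toLw + F :=
      (MemLw.toLw_eq_add (hPn.sub hf₀) hf₀ hPn (by simp)).trans (by rw [hf₀F])
    rw [← (hPn.sub hf₀).enorm_toLw, edist_eq_enorm_sub, ← hP]
    change ‖hPn.toLw - F‖ₑ = _
    rw [h2, add_sub_cancel_right]
  -- Convolving the $L_{r,m}$ limit with $K$ selects the right representative: the partial sums are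
  -- fixed by this convolution, so they converge to it at every point.
  refine ⟨⟨conv μ f₀ S.K, h.conv_memRKS hf₀⟩, ?_, fun x => ?_⟩
  · refine (S.normLw_conv_K_le h.moderate h.one_lt h.rightConv hf₀).trans ?_
    rw [mul_assoc]
    gcongr
    rw [← hf₀.enorm_toLw, hf₀F]
    refine (enorm_tsum_le_tsum_enorm).trans ((ENNReal.tsum_le_tsum hu).trans (le_of_eq ?_))
    rw [ENNReal.tsum_mul_right, ENNReal.tsum_geometric]
  · refine (S.tendsto_conv_K_of_moderate h.moderate h.one_lt (fun n => (P n).2.1) hf₀ hlim x).congr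
      fun n => ?_
    rw [(P n).2.2 x]
    exact congrFun (h.coe_sum_residualMap_pow g n) x

lemma memLw_synth_of_mem {a : I → ℂ} (ha : a ∈ seqSpace (m ∘ X) r) : MemLw μ m r (synth ψ a) := by
  have r0 : 0 < r := by linarith [h.one_lt]
  obtain ⟨D, hD⟩ := h.bupu.exists_normLw_synth_le (μ := μ) h.compact h.nhds S.isControlWeight
    h.moderate h.one_lt
  refine ⟨(Complex.continuous_ofReal.comp h.moderate.continuous).aestronglyMeasurable.mul
    (h.bupu.measurable_synth h.compact h.nhds _).aestronglyMeasurable, ?_⟩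
  refine lt_of_le_of_lt (hD a) (ENNReal.mul_lt_top ENNReal.coe_lt_top
    (ENNReal.rpow_lt_top_of_nonneg (by positivity) ?_))
  exact (seqSum_ne_top_iff _ r0 _).2 ha

/-- The function `(∑ c_i ψ_i) * K` in the reproducing kernel space. -/
noncomputable def initial (a : seqSpace (m ∘ X) r) : h.rks :=
  ⟨conv μ (synth ψ a.1) S.K, h.conv_memRKS (h.memLw_synth_of_mem a.2)⟩

/-- The Neumann limit $f$ lies in the reproducing space, so $f=f*K$ is the voice transform of a
distribution; this distribution is the one that `reconstruct` selects. -/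
lemma reconstruct_spec : ∃ E : ℝ≥0, ∀ a : seqSpace (m ∘ X) r,
    S.IsReconstruction X ψ a.1 (S.reconstruct X ψ a.1) ∧
    MemLw μ m r (S.extVoice (S.reconstruct X ψ a.1)) ∧
    normLw μ m r (S.extVoice (S.reconstruct X ψ a.1)) ≤ E * seqSum (m ∘ X) r a.1 ^ (1 / r) := by
  obtain ⟨E, hE⟩ := h.exists_limit
  obtain ⟨D, hD⟩ := h.bupu.exists_normLw_synth_le (μ := μ) h.compact h.nhds S.isControlWeight
    h.moderate h.one_lt
  have hRt := S.rightConvNorm_ne_top h.moderate h.one_lt h.rightConv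
  refine ⟨E * ((rightConvNorm μ m r S.K).toNNReal * D), fun a => ?_⟩
  obtain ⟨f, hfE, hf⟩ := hE (h.initial a)
  obtain ⟨T, hT⟩ := S.exists_distribution h.one_lt (S.memLw_wInv h.moderate f.2.1)
  rw [funext f.2.2] at hT
  have hTr : S.IsReconstruction X ψ a.1 T := fun x => by rw [hT]; exact hf x
  rw [hTr.reconstruct_eq, hT]
  refine ⟨hTr, f.2.1, hfE.trans ?_⟩
  rw [ENNReal.coe_mul, ENNReal.coe_mul, ENNReal.coe_toNNReal hRt, mul_assoc, mul_assoc]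
  gcongr
  refine (S.normLw_conv_K_le h.moderate h.one_lt h.rightConv (h.memLw_synth_of_mem a.2)).trans ?_
  gcongr
  exact hD a.1

lemma initial_add (a b : seqSpace (m ∘ X) r) : h.initial (a + b) = h.initial a + h.initial b := by
  refine Subtype.ext ?_
  change conv μ (synth ψ (a.1 + b.1)) S.K = conv μ (synth ψ a.1) S.K + conv μ (synth ψ b.1) S.K
  rw [h.bupu.synth_add h.compact h.nhds, h.conv_add (h.memLw_synth_of_mem a.2)
    (h.memLw_synth_of_mem b.2)]

lemma initial_smul (t : ℂ) (a : seqSpace (m ∘ X) r) : h.initial (t • a) = t • h.initial a := by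
  refine Subtype.ext ?_
  change conv μ (synth ψ (t • a.1)) S.K = t • conv μ (synth ψ a.1) S.K
  rw [h.bupu.synth_smul h.compact h.nhds, S.conv_K_smul]

/-- The reconstruction operator on `ℓ_{r,m_X}(I)`. -/
noncomputable def reconstructMap : seqSpace (m ∘ X) r →ₗ[ℂ] S.Co r m where
  toFun a := ⟨S.reconstruct X ψ a.1, (h.reconstruct_spec.choose_spec a).2.1⟩
  map_add' a b := by
    -- Uniqueness reduces additivity of the chosen distributions to that of the partial sums.
    refine Subtype.ext (IsReconstruction.reconstruct_eq fun x => ?_)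
    have ha := (h.reconstruct_spec.choose_spec a).1 x
    have hb := (h.reconstruct_spec.choose_spec b).1 x
    change Tendsto _ _ (𝓝 (S.extVoice (S.reconstruct X ψ a.1 + S.reconstruct X ψ b.1) x))
    rw [S.extVoice_add]
    refine (ha.add hb).congr fun n => ?_
    have e := congrArg (fun f : h.rks => (((∑ k ∈ Finset.range n, h.residualMap ^ k) f : h.rks) :
      G → ℂ) x) (h.initial_add a b)
    simp only [map_add, Submodule.coe_add, Pi.add_apply, coe_sum_residualMap_pow] at e
    exact e.symm
  map_smul' t a := by
    refine Subtype.ext (IsReconstruction.reconstruct_eq fun x => ?_)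
    have ha := (h.reconstruct_spec.choose_spec a).1 x
    change Tendsto _ _ (𝓝 (S.extVoice (t • S.reconstruct X ψ a.1) x))
    rw [S.extVoice_smul]
    refine (ha.const_mul t).congr fun n => ?_
    have e := congrArg (fun f : h.rks => (((∑ k ∈ Finset.range n, h.residualMap ^ k) f : h.rks) :
      G → ℂ) x) (h.initial_smul t a)
    simp only [map_smul, Submodule.coe_smul, Pi.smul_apply, coe_sum_residualMap_pow] at e
    exact e.symm

lemma extVoice_memRKS {T : S.Distribution} (hT : T ∈ S.Co r m) :
    MemRKS μ m r S.K (S.extVoice T) := ⟨hT, S.conv_extVoice T⟩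

/-- For $g=F-EF$ the sum telescopes, $\sum_{k<n}E^kg=F-E^nF$, and $E^nF\to0$ at every point. -/
lemma isReconstruction_samp {T : S.Distribution} (hT : T ∈ S.Co r m) :
    S.IsReconstruction X ψ (S.samp X T) T := by
  intro x
  let F : h.rks := ⟨S.extVoice T, h.extVoice_memRKS hT⟩
  let g : h.rks := F - h.residualMap F
  have hg : conv μ (synth ψ (S.samp X T)) S.K = g.1 := by
    change _ = S.extVoice T - (S.extVoice T - conv μ (synth ψ (S.extVoice T ∘ X)) S.K)
    rw [sub_sub_cancel]; rfl
  rw [hg]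
  have h1 : ∀ n, S.neumannSum X ψ g.1 n x
      = S.extVoice T x - (((h.residualMap ^ n) F : h.rks) : G → ℂ) x := by
    intro n
    rw [← h.coe_sum_residualMap_pow]
    have h2 := LinearMap.congr_fun (geom_sum_mul_neg h.residualMap n) F
    have h3 : (∑ k ∈ Finset.range n, h.residualMap ^ k) g = F - (h.residualMap ^ n) F := h2
    rw [h3]; rfl
  simp_rw [h1]
  simpa using tendsto_const_nhds.sub (h.tendsto_residualMap_pow F x)

lemma exists_samp_bound : ∃ b : ℝ≥0, ∀ T ∈ S.Co r m,
    seqSum (m ∘ X) r (S.samp X T) ^ (1 / r) ≤ b * normLw μ m r (S.extVoice T) := by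
  have r0 : 0 < r := by linarith [h.one_lt]
  obtain ⟨D, hD⟩ := h.bupu.exists_seqSum_le (μ := μ) h.compact h.nhds S.isControlWeight
    h.moderate h.one_lt
  have hb : ((D : ℝ≥0∞) * (1 + (c : ℝ≥0∞) ^ r)) ^ (1 / r) ≠ ∞ :=
    ENNReal.rpow_ne_top_of_nonneg (by positivity) (ENNReal.mul_ne_top ENNReal.coe_ne_top
      (ENNReal.add_ne_top.2 ⟨ENNReal.one_ne_top,
        ENNReal.rpow_ne_top_of_nonneg r0.le ENNReal.coe_ne_top⟩))
  refine ⟨(((D : ℝ≥0∞) * (1 + (c : ℝ≥0∞) ^ r)) ^ (1 / r)).toNNReal, fun T hT => ?_⟩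
  rw [ENNReal.coe_toNNReal hb]
  set N := normLw μ m r (S.extVoice T) with hN
  have h1 : seqSum (m ∘ X) r (S.samp X T) ≤ (D : ℝ≥0∞) * (1 + (c : ℝ≥0∞) ^ r) * N ^ r := by
    refine (hD _ hT).trans ?_
    rw [mul_assoc, add_mul, one_mul, ← ENNReal.mul_rpow_of_nonneg _ _ r0.le]
    gcongr
    exact h.osc_le _ (h.extVoice_memRKS hT)
  refine (ENNReal.rpow_le_rpow h1 (by positivity : 0 ≤ 1 / r)).trans (le_of_eq ?_)
  rw [ENNReal.mul_rpow_of_nonneg _ _ (by positivity), ← ENNReal.rpow_mul,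
    mul_one_div_cancel r0.ne', ENNReal.rpow_one]

/-- The points `x_i` yield a Banach frame. -/
theorem isBanachFrame : S.IsBanachFrame r m X h.reconstructMap := by
  have r0 : 0 < r := by linarith [h.one_lt]
  have r1 : 0 ≤ 1 / r := by positivity
  obtain ⟨b, hb⟩ := h.exists_samp_bound
  obtain ⟨E, hE⟩ := h.reconstruct_spec
  have hmX : ∀ i, 0 ≤ (m ∘ X) i := fun i => (h.moderate.pos _).le
  have hfin : ∀ a : I → ℂ, a ∈ seqSpace (m ∘ X) r → seqSum (m ∘ X) r a ^ (1 / r) ≠ ∞ :=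
    fun a ha => ENNReal.rpow_ne_top_of_nonneg r1 ((seqSum_ne_top_iff _ r0 _).2 ha)
  have hmem : ∀ T ∈ S.Co r m, S.samp X T ∈ seqSpace (m ∘ X) r := by
    intro T hT
    rw [← seqSum_ne_top_iff _ r0]
    intro htop
    have h1 := hb T hT
    rw [htop, ENNReal.top_rpow_of_pos (by positivity)] at h1
    exact absurd (top_le_iff.1 h1) (ENNReal.mul_ne_top ENNReal.coe_ne_top hT.2.ne)
  have hrec : ∀ a : seqSpace (m ∘ X) r,
      S.coNorm r m (h.reconstructMap a : S.Distribution) ≤ E * seqNorm (m ∘ X) r a.1 := by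
    intro a
    have h1 := ENNReal.toReal_mono (ENNReal.mul_ne_top ENNReal.coe_ne_top (hfin _ a.2)) (hE a).2.2
    rw [ENNReal.toReal_mul, ENNReal.coe_toReal] at h1
    rw [seqNorm_eq _ hmX r0]
    exact h1
  have hid : ∀ (T : S.Distribution) (hT : T ∈ S.Co r m),
      h.reconstructMap ⟨S.samp X T, hmem T hT⟩ = ⟨T, hT⟩ := fun T hT =>
    Subtype.ext (h.isReconstruction_samp hT).reconstruct_eq
  refine ⟨fun i => ?_, hmem, ⟨b, fun T hT => ?_⟩, ⟨((E : ℝ) + 1)⁻¹, by positivity, fun T hT => ?_⟩,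
    ⟨E, hrec⟩, hid⟩
  · obtain ⟨C, hC, hCx⟩ := S.exists_enorm_conv_K_le h.one_lt (X i)
    refine ⟨(C * ENNReal.ofReal (m 1)⁻¹).toReal, fun T hT => ?_⟩
    have h1 := hCx _ (S.memLw_wInv h.moderate hT)
    rw [S.conv_extVoice] at h1
    have h2 : ‖S.extVoice T (X i)‖ₑ ≤
        C * ENNReal.ofReal (m 1)⁻¹ * normLw μ m r (S.extVoice T) := by
      refine h1.trans ?_
      rw [mul_assoc]
      gcongr
      exact S.normLw_wInv_le h.moderate _
    have h3 := ENNReal.toReal_mono (ENNReal.mul_ne_top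
      (ENNReal.mul_ne_top hC ENNReal.ofReal_ne_top) hT.2.ne) h2
    rwa [toReal_enorm, ENNReal.toReal_mul] at h3
  · have h1 := ENNReal.toReal_mono (ENNReal.mul_ne_top ENNReal.coe_ne_top hT.2.ne) (hb T hT)
    rw [ENNReal.toReal_mul, ENNReal.coe_toReal] at h1
    rw [seqNorm_eq _ hmX r0]
    exact h1
  -- The lower bound is the boundedness of the left inverse. The constant $(E+1)^{-1}$ avoids
  -- dividing by a possibly vanishing $E$.
  · have h1 := hrec ⟨S.samp X T, hmem T hT⟩
    rw [hid T hT] at h1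
    have h2 : 0 ≤ seqNorm (m ∘ X) r (S.samp X T) := by
      rw [seqNorm_eq _ hmX r0]; exact ENNReal.toReal_nonneg
    rw [inv_mul_le_iff₀ (by positivity)]
    nlinarith

end NeumannHypotheses

end Setting

end Coorbit

namespace Coorbit

/-! ### Inversion and the modular function -/

section Inversion

variable {G : Type*} [TopologicalSpace G] [Group G] [IsTopologicalGroup G] [LocallyCompactSpace G]
  [SecondCountableTopology G] [T2Space G] [MeasurableSpace G] [BorelSpace G]
  (μ : Measure G) [μ.IsHaarMeasure]

lemma measure_preimage_mul_right_eq (y : G) (s : Set G) :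
    μ ((fun x => x * y) ⁻¹' s) = (Measure.modularCharacter y : ℝ≥0) * μ s := by
  have h1 := Measure.map_right_mul_eq_modularCharacterFun_smul (μ := μ) y
  have h2 : Measure.map (· * y) μ s = μ ((fun x => x * y) ⁻¹' s) :=
    (MeasurableEquiv.mulRight y).map_apply s
  rw [← h2, h1]
  rfl

/-- Right translation by $y$ scales the measure of a fixed compact set $s$ by the modular character.
Mathlib's inversion formula involving that ratio, applied to the product of the character and $g$,
makes the character cancel under the reflected integral. -/
lemma lintegral_inv_eq {g : G → ℝ≥0∞} (hg : Measurable g) :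
    ∫⁻ y, g y⁻¹ ∂μ = ∫⁻ y, (Measure.modularCharacter y : ℝ≥0) * g y ∂μ := by
  obtain ⟨s, hsc, hs1⟩ := exists_compact_mem_nhds (1 : G)
  have hs0 : μ s ≠ 0 := (μ.measure_pos_of_mem_nhds hs1).ne'
  have hst : μ s ≠ ∞ := hsc.measure_lt_top.ne
  have hsm : MeasurableSet s := hsc.isClosed.measurableSet
  have hχ : Measurable fun y : G => ((Measure.modularCharacter y : ℝ≥0) : ℝ≥0∞) := by
    have h := (measurable_measure_mul_right μ hsm).div_const (μ s)
    simpa only [measure_preimage_mul_right_eq, ENNReal.mul_div_cancel_right hs0 hst] using h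
  have key := measure_lintegral_div_measure μ μ hsm hs0 hst _ (hχ.mul hg)
  simp only [Pi.mul_apply] at key
  rw [← key, ← lintegral_const_mul' _ _ hst]
  refine lintegral_congr fun y => ?_
  have h0 : ((Measure.modularCharacter y⁻¹ : ℝ≥0) : ℝ≥0∞) ≠ 0 := by
    exact ENNReal.coe_ne_zero.2 (Measure.modularCharacterFun_pos y⁻¹).ne'
  rw [measure_preimage_mul_right_eq, ENNReal.mul_div_mul_left _ _ h0 ENNReal.coe_ne_top,
    ENNReal.mul_div_cancel hs0 hst]

end Inversion

/-! ### Young's inequality without unimodularity -/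

section Young

variable {G : Type*} [TopologicalSpace G] [Group G] [IsTopologicalGroup G] [LocallyCompactSpace G]
  [SecondCountableTopology G] [MeasurableSpace G] [BorelSpace G]
  (μ : Measure G) [μ.IsHaarMeasure]

/-- Young's inequality for `L_r * L_1` on a group that need not be unimodular. -/
lemma lintegral_conv_rpow_le {r : ℝ} (hr : 1 < r) {F g : G → ℝ≥0∞} (hF : AEMeasurable F μ)
    (hg : Measurable g) :
    (∫⁻ x, (∫⁻ y, F y * g (y⁻¹ * x) ∂μ) ^ r ∂μ) ^ (1 / r) ≤
      (∫⁻ x, g x ∂μ + ∫⁻ x, g x⁻¹ ∂μ) * (∫⁻ y, F y ^ r ∂μ) ^ (1 / r) := by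
  have hr0 : 0 < r := by linarith
  obtain ⟨r', hrr⟩ : ∃ r', r.HolderConjugate r' := ⟨_, Real.HolderConjugate.conjExponent hr⟩
  set A := ∫⁻ x, g x ∂μ
  set B := ∫⁻ x, g x⁻¹ ∂μ
  have hsum : 1 / r + 1 / r' = 1 := by simpa [one_div] using hrr.inv_add_inv_eq_one
  have hgx (x : G) : Measurable fun y => g (y⁻¹ * x) := by fun_prop
  have hB (x : G) : ∫⁻ y, g (y⁻¹ * x) ∂μ = B := by
    have := lintegral_mul_left_eq_self (μ := μ) (fun y => g y⁻¹) x⁻¹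
    simpa using this
  -- Hölder after splitting $g=g^{1/r}g^{1/r'}$; the factor with exponent $r'$ integrates, in the
  -- inverted variable, to the mass $B$ of the reflection.
  have h1 (x : G) : (∫⁻ y, F y * g (y⁻¹ * x) ∂μ) ^ r ≤
      (∫⁻ y, F y ^ r * g (y⁻¹ * x) ∂μ) * B ^ (r / r') := by
    have h2 := ENNReal.lintegral_mul_le_Lp_mul_Lq μ hrr
      (hF.mul ((hgx x).pow_const (1 / r)).aemeasurable)
      ((hgx x).pow_const (1 / r')).aemeasurable
    have e1 (y : G) : F y * g (y⁻¹ * x) = F y * g (y⁻¹ * x) ^ (1 / r) * g (y⁻¹ * x) ^ (1 / r') := by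
      rw [mul_assoc, ← ENNReal.rpow_add_of_nonneg _ _ hrr.one_div_nonneg hrr.symm.one_div_nonneg,
        hsum, ENNReal.rpow_one]
    have e2 (y : G) : (F y * g (y⁻¹ * x) ^ (1 / r)) ^ r = F y ^ r * g (y⁻¹ * x) := by
      rw [ENNReal.mul_rpow_of_nonneg _ _ hr0.le, ← ENNReal.rpow_mul, one_div,
        inv_mul_cancel₀ hr0.ne', ENNReal.rpow_one]
    have e3 (y : G) : (g (y⁻¹ * x) ^ (1 / r')) ^ r' = g (y⁻¹ * x) := by
      rw [← ENNReal.rpow_mul, one_div, inv_mul_cancel₀ hrr.symm.ne_zero, ENNReal.rpow_one]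
    simp only [Pi.mul_apply, e2, e3, ← e1, hB] at h2
    refine (ENNReal.rpow_le_rpow h2 hr0.le).trans_eq ?_
    rw [ENNReal.mul_rpow_of_nonneg _ _ hr0.le, ← ENNReal.rpow_mul, ← ENNReal.rpow_mul, one_div,
      inv_mul_cancel₀ hr0.ne', ENNReal.rpow_one, one_div_mul_eq_div]
  have hm : AEMeasurable (Function.uncurry fun x y => F y ^ r * g (y⁻¹ * x)) (μ.prod μ) :=
    (hF.comp_snd.pow_const r).mul (Measurable.aemeasurable (by fun_prop))
  have h2 : ∫⁻ x, ∫⁻ y, F y ^ r * g (y⁻¹ * x) ∂μ ∂μ = A * ∫⁻ y, F y ^ r ∂μ := by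
    rw [lintegral_lintegral_swap hm, mul_comm, ← lintegral_mul_const'' _ (hF.pow_const r)]
    refine lintegral_congr fun y => ?_
    have h3 : Measurable fun x => g (y⁻¹ * x) := by fun_prop
    rw [lintegral_const_mul _ h3, lintegral_mul_left_eq_self]
  -- The sum is a cruder constant, but it does not depend on $r$.
  have h3 : A ^ (1 / r) * B ^ (1 / r') ≤ A + B := by
    calc A ^ (1 / r) * B ^ (1 / r') ≤ (A + B) ^ (1 / r) * (A + B) ^ (1 / r') := by
          refine mul_le_mul' (ENNReal.rpow_le_rpow le_self_add hrr.one_div_nonneg)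
            (ENNReal.rpow_le_rpow le_add_self hrr.symm.one_div_nonneg)
      _ = A + B := by
          rw [← ENNReal.rpow_add_of_nonneg _ _ hrr.one_div_nonneg hrr.symm.one_div_nonneg,
            hsum, ENNReal.rpow_one]
  calc (∫⁻ x, (∫⁻ y, F y * g (y⁻¹ * x) ∂μ) ^ r ∂μ) ^ (1 / r)
      ≤ (∫⁻ x, (∫⁻ y, F y ^ r * g (y⁻¹ * x) ∂μ) * B ^ (r / r') ∂μ) ^ (1 / r) :=
        ENNReal.rpow_le_rpow (lintegral_mono h1) hrr.one_div_nonneg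
    _ = (A * (∫⁻ y, F y ^ r ∂μ) * B ^ (r / r')) ^ (1 / r) := by
        have h4 : AEMeasurable (fun x => ∫⁻ y, F y ^ r * g (y⁻¹ * x) ∂μ) μ :=
          hm.lintegral_prod_right'
        rw [lintegral_mul_const'' _ h4, h2]
    _ = A ^ (1 / r) * B ^ (1 / r') * (∫⁻ y, F y ^ r ∂μ) ^ (1 / r) := by
        rw [ENNReal.mul_rpow_of_nonneg _ _ hrr.one_div_nonneg,
          ENNReal.mul_rpow_of_nonneg _ _ hrr.one_div_nonneg, ← ENNReal.rpow_mul,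
          show r / r' * (1 / r) = 1 / r' by field_simp]
        ring
    _ ≤ _ := mul_le_mul_left h3 _

end Young

/-! ### Local suprema and oscillation of a continuous function -/

section Oscillation

variable {G : Type*} [TopologicalSpace G] [Group G] [IsTopologicalGroup G]

/-- The supremum of `‖W‖` over the translate `xU`. -/
noncomputable def localSup (U : Set G) (W : G → ℂ) (x : G) : ℝ≥0∞ := ⨆ u ∈ U, ‖W (x * u)‖ₑ

lemma oscRight_mono {U V : Set G} (h : U ⊆ V) (W : G → ℂ) (x : G) :
    oscRight U W x ≤ oscRight V W x :=
  biSup_mono fun _ hu => h hu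

lemma enorm_le_localSup {V : Set G} {W : G → ℂ} {x u : G} (hu : u ∈ V) :
    ‖W (x * u)‖ₑ ≤ localSup V W x :=
  le_iSup₂ (f := fun u (_ : u ∈ V) => ‖W (x * u)‖ₑ) u hu

lemma oscRight_le_localSup {V : Set G} (hV : (1 : G) ∈ V) (W : G → ℂ) (x : G) :
    oscRight V W x ≤ 2 * localSup V W x := by
  refine iSup₂_le fun u hu => (enorm_sub_le).trans ?_
  rw [two_mul]
  refine add_le_add (enorm_le_localSup hu) ?_
  simpa using enorm_le_localSup (W := W) (x := x) hV

variable [MeasurableSpace G] [BorelSpace G]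

/-- Continuity of $W$ makes this supremum lower semicontinuous, even over an arbitrary uncountable
set. -/
lemma measurable_localSup (V : Set G) {W : G → ℂ} (hW : Continuous W) :
    Measurable (localSup V W) :=
  (lowerSemicontinuous_biSup fun u _ =>
    (by fun_prop : Continuous fun x => ‖W (x * u)‖ₑ).lowerSemicontinuous).measurable

lemma measurable_oscRight (V : Set G) {W : G → ℂ} (hW : Continuous W) :
    Measurable (oscRight V W) :=
  (lowerSemicontinuous_biSup fun u _ =>
    (by fun_prop : Continuous fun x => ‖W (x * u) - W x‖ₑ).lowerSemicontinuous).measurable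

/-- If $|W|$ exceeded the essential supremum at a point of $x\cdot\mathrm{int}\,Q$, it would do so
on a nonempty open set, which has positive measure. -/
lemma localSup_le_localMax {μ : Measure G} [μ.IsOpenPosMeasure] {Q : Set G} {W : G → ℂ}
    (hW : Continuous W) (x : G) : localSup (interior Q) W x ≤ localMax μ Q W x := by
  refine iSup₂_le fun u hu => ?_
  by_contra! hlt
  have hO : IsOpen (x • interior Q ∩ {y | localMax μ Q W x < ‖W y‖ₑ}) :=
    (isOpen_interior.smul x).inter (isOpen_lt continuous_const hW.enorm)
  refine (hO.measure_pos μ ⟨x * u, Set.smul_mem_smul_set hu, hlt⟩).ne' ?_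
  have h1 := ae_iff.1 (ae_le_eLpNormEssSup (f := W) (μ := μ.restrict (x • Q)))
  rw [← Set.inter_eq_self_of_subset_left (Set.inter_subset_left.trans
    (Set.smul_set_mono (a := x) (interior_subset (s := Q)))), ← Measure.restrict_apply hO.measurableSet]
  refine measure_mono_null (fun y hy => ?_) h1
  simpa [localMax] using hy.2

lemma tendsto_oscRight {V : ℕ → Set G} (hV : (𝓝 (1 : G)).HasAntitoneBasis V) {W : G → ℂ}
    (hW : Continuous W) (x : G) : Tendsto (fun n => oscRight (V n) W x) atTop (𝓝 0) := by
  rw [ENNReal.tendsto_atTop_zero]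
  intro ε hε
  have h1 : Tendsto (fun u => ‖W (x * u) - W x‖ₑ) (𝓝 1) (𝓝 0) := by
    have : Continuous fun u => ‖W (x * u) - W x‖ₑ := by fun_prop
    simpa using this.tendsto 1
  obtain ⟨n, -, hn⟩ := hV.1.mem_iff.1 (h1.eventually_le_const hε)
  exact ⟨n, fun k hk => iSup₂_le fun u hu => hn (hV.2 hk hu)⟩

end Oscillation

end Coorbit

/-! ### Oscillation estimates from a good kernel -/

namespace Coorbit

lemma enorm_coe_of_nonneg {a : ℝ} (ha : 0 ≤ a) : ‖(a : ℂ)‖ₑ = ENNReal.ofReal a := by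
  rw [← ofReal_norm, Complex.norm_of_nonneg ha]

lemma memLp_of_lintegral_of_bound {α : Type*} [MeasurableSpace α] {μ : Measure α} {f : α → ℂ}
    (hf : AEStronglyMeasurable f μ) (h1 : ∫⁻ x, ‖f x‖ₑ ∂μ < ∞) {D : ℝ≥0} (hD : ∀ x, ‖f x‖ₑ ≤ D)
    {p : ℝ} (hp : 1 < p) : MemLp f (ENNReal.ofReal p) μ := by
  have hp0 : 0 < p := by linarith
  refine ⟨hf, (eLpNorm_lt_top_iff_lintegral_rpow_enorm_lt_top (by simpa using hp0)
    ENNReal.ofReal_ne_top).2 ?_⟩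
  rw [ENNReal.toReal_ofReal hp0.le]
  refine lt_of_le_of_lt (lintegral_mono (g := fun x => (D : ℝ≥0∞) ^ (p - 1) * ‖f x‖ₑ) fun x => ?_) ?_
  · calc ‖f x‖ₑ ^ p = ‖f x‖ₑ ^ (p - 1) * ‖f x‖ₑ := by
          nth_rw 3 [← ENNReal.rpow_one ‖f x‖ₑ]
          rw [← ENNReal.rpow_add_of_nonneg _ _ (by linarith) zero_le_one, sub_add_cancel]
      _ ≤ _ := mul_le_mul_left (ENNReal.rpow_le_rpow (hD x) (by linarith)) _
  · rw [lintegral_const_mul'' _ hf.enorm]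
    exact ENNReal.mul_lt_top (ENNReal.rpow_lt_top_of_nonneg (by linarith) ENNReal.coe_ne_top) h1

namespace Setting

variable {G : Type*} [TopologicalSpace G] [Group G] [IsTopologicalGroup G] [LocallyCompactSpace G]
  [SecondCountableTopology G] [T2Space G] [MeasurableSpace G] [BorelSpace G]
  {μ : Measure G} [μ.IsHaarMeasure]
  {H : Type*} [NormedAddCommGroup H] [InnerProductSpace ℂ H] (S : Setting μ H)

/-- The weighted `L_1` mass of the right oscillation of `W`, and of its reflection. -/
noncomputable def oscMass (W : G → ℂ) (U : Set G) : ℝ≥0∞ :=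
  ∫⁻ x, ENNReal.ofReal (S.w x) * oscRight U W x ∂μ +
    ∫⁻ x, ENNReal.ofReal (S.w x⁻¹) * oscRight U W x⁻¹ ∂μ

lemma oscMass_mono (W : G → ℂ) {U V : Set G} (h : U ⊆ V) : S.oscMass W U ≤ S.oscMass W V :=
  add_le_add (lintegral_mono fun _ => mul_le_mul_right (oscRight_mono h W _) _)
    (lintegral_mono fun _ => mul_le_mul_right (oscRight_mono h W _) _)

/-- The weighted local maximal function over `V` and its reflection are integrable. -/
structure HasIntegrableMax (V : Set G) (W : G → ℂ) : Prop where
  nhds : V ∈ 𝓝 (1 : G)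
  continuous : Continuous W
  bound : ∃ B : ℝ≥0, ∀ u ∈ V, S.w u ≤ B
  lintegral : ∫⁻ x, ENNReal.ofReal (S.w x) * localSup V W x ∂μ < ∞
  lintegral_inv : ∫⁻ x, ENNReal.ofReal (S.w x⁻¹) * localSup V W x⁻¹ ∂μ < ∞

variable {S} {W : G → ℂ} {V : Set G}

/-- The hypothesis with weight $w\Delta^{-1}$ is exactly integrability of the reflected function, by
the inversion formula. Passing to the interior of $Q$ replaces essential suprema by true ones. -/
lemma IsGoodKernel.exists_hasIntegrableMax (hW : S.IsGoodKernel W) :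
    ∃ V, S.HasIntegrableMax V W := by
  obtain ⟨Q, hQ, hQ1, hi, hi'⟩ := hW.localMax_integrable
  have hle := localSup_le_localMax (μ := μ) (Q := Q) hW.continuous
  have hwm : Measurable fun x => ENNReal.ofReal (S.w x) :=
    S.isControlWeight.continuous.measurable.ennreal_ofReal
  obtain ⟨B, hB⟩ := exists_bound_on_compact S.isControlWeight hQ
  refine ⟨interior Q, interior_mem_nhds.2 hQ1, hW.continuous,
    ⟨B, fun u hu => hB u (interior_subset hu)⟩,
    (lintegral_mono fun x => mul_le_mul_right (hle x) _).trans_lt hi, ?_⟩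
  have hinv := lintegral_inv_eq μ (hwm.mul (measurable_localSup (interior Q) hW.continuous))
  simp only [Pi.mul_apply] at hinv
  rw [hinv]
  refine (lintegral_mono fun x => ?_).trans_lt hi'
  rw [ENNReal.ofReal_mul (S.w_pos x).le, modularFunction, inv_inv, ENNReal.ofReal_coe_nnreal,
    ← mul_assoc, mul_comm ((Measure.modularCharacter x : ℝ≥0) : ℝ≥0∞)]
  exact mul_le_mul_right (hle x) _

namespace HasIntegrableMax

variable (h : S.HasIntegrableMax V W)

include h

lemma measurable_weighted : Measurable fun x => ENNReal.ofReal (S.w x) * localSup V W x :=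
  S.isControlWeight.continuous.measurable.ennreal_ofReal.mul (measurable_localSup V h.continuous)

lemma measurable_weighted_inv :
    Measurable fun x => ENNReal.ofReal (S.w x⁻¹) * localSup V W x⁻¹ :=
  h.measurable_weighted.comp measurable_inv

lemma enorm_le (x : G) : ‖W x‖ₑ ≤ localSup V W x := by
  simpa using enorm_le_localSup (W := W) (x := x) (mem_of_mem_nhds h.nhds)

/-- For $y\in xV^{-1}$ the value $w(x)|W(x)|$ is at most $B\,w(y)$ times the local supremum at $y$.
All sets $xV^{-1}$ have the same positive measure, so Markov's inequality bounds it uniformly. -/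
lemma exists_bound : ∃ D : ℝ≥0, ∀ x, ‖(S.w x : ℂ) * W x‖ₑ ≤ D := by
  obtain ⟨B, hB⟩ := h.bound
  have hV : μ V⁻¹ ≠ 0 := (μ.measure_pos_of_mem_nhds (inv_mem_nhds_one G h.nhds)).ne'
  have hBm := h.measurable_weighted.const_mul (B : ℝ≥0∞)
  set E := ∫⁻ x, B * (ENNReal.ofReal (S.w x) * localSup V W x) ∂μ with hE
  have hEt : E ≠ ∞ := by
    rw [hE, lintegral_const_mul _ h.measurable_weighted]
    exact ENNReal.mul_ne_top ENNReal.coe_ne_top h.lintegral.ne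
  refine ⟨(E / μ V⁻¹).toNNReal, fun x => ?_⟩
  rw [ENNReal.coe_toNNReal (ENNReal.div_lt_top hEt hV).ne]
  have h1 := mul_meas_ge_le_lintegral (μ := μ) hBm ‖(S.w x : ℂ) * W x‖ₑ
  rw [ENNReal.le_div_iff_mul_le (Or.inl hV) (Or.inr hEt)]
  refine le_trans (mul_le_mul_right ?_ _) h1
  rw [← measure_smul μ x V⁻¹]
  refine measure_mono ?_
  rintro _ ⟨v, hv, rfl⟩
  simp only [smul_eq_mul, Set.mem_ofPred_eq]
  have h2 : S.w x ≤ B * S.w (x * v) := by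
    have h3 := S.isControlWeight.submul (x * v) v⁻¹
    rw [mul_inv_cancel_right, mul_comm] at h3
    exact h3.trans (mul_le_mul_of_nonneg_right (hB _ hv) (S.w_pos _).le)
  have h4 : ‖W x‖ₑ ≤ localSup V W (x * v) := by
    simpa using enorm_le_localSup (W := W) (x := x * v) (Set.mem_inv.1 hv)
  rw [enorm_mul, ← mul_assoc]
  refine mul_le_mul' ?_ h4
  rw [enorm_coe_of_nonneg (S.w_pos x).le, ← ENNReal.ofReal_coe_nnreal,
    ← ENNReal.ofReal_mul B.coe_nonneg]
  exact ENNReal.ofReal_le_ofReal h2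

/-- Bounded integrable functions lie in every $L_p$ with $p>1$. The variable is inverted, so the
reflected mass provides the integrability. -/
lemma memLw_translate {p : ℝ} (hp : 1 < p) (x : G) : MemLw μ S.w p fun z => W (z⁻¹ * x) := by
  obtain ⟨D, hD⟩ := h.exists_bound
  have hc := h.continuous
  have hwc := S.isControlWeight.continuous
  have h1 : MemLp (fun z => (S.w (z⁻¹ * x) : ℂ) * W (z⁻¹ * x)) (ENNReal.ofReal p) μ := by
    refine memLp_of_lintegral_of_bound (Continuous.aestronglyMeasurable (by fun_prop)) ?_
      (fun z => hD _) hp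
    have h2 := lintegral_mul_left_eq_self (μ := μ)
      (fun z => ‖(S.w z⁻¹ : ℂ) * W z⁻¹‖ₑ) x⁻¹
    simp only [mul_inv_rev, inv_inv] at h2
    rw [h2]
    refine (lintegral_mono fun z => ?_).trans_lt h.lintegral_inv
    rw [enorm_mul, enorm_coe_of_nonneg (S.w_pos _).le]
    exact mul_le_mul_right (h.enorm_le _) _
  refine h1.of_le_mul (c := S.w x) (Continuous.aestronglyMeasurable (by fun_prop))
    (Eventually.of_forall fun z => ?_)
  have h3 : S.w z ≤ S.w x * S.w (z⁻¹ * x) := by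
    have := S.isControlWeight.submul x (z⁻¹ * x)⁻¹
    rwa [S.isControlWeight.symm, mul_inv_rev, inv_inv, mul_inv_cancel_left] at this
  rw [norm_mul, norm_mul, Complex.norm_of_nonneg (S.w_pos _).le,
    Complex.norm_of_nonneg (S.w_pos _).le, ← mul_assoc]
  exact mul_le_mul_of_nonneg_right h3 (norm_nonneg _)

lemma integrable_mul_translate {r : ℝ} (hr : 1 < r) {f : G → ℂ} (hf : MemLw μ S.wInv r f) (x : G) :
    Integrable (fun y => f y * W (y⁻¹ * x)) μ := by
  have hrr := Real.HolderConjugate.conjExponent hr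
  have hF := h.memLw_translate hrr.symm.lt x
  have hc := h.continuous
  refine ⟨(S.aestronglyMeasurable_of_memLw_wInv hf).mul
    (Continuous.aestronglyMeasurable (by fun_prop)), ?_⟩
  exact (lintegral_enorm_mul_le S.w_pos hrr hf hF).trans_lt (ENNReal.mul_lt_top hf.2 hF.2)

lemma weighted_oscRight_le {U : Set G} (hU : U ⊆ V) (x : G) :
    ENNReal.ofReal (S.w x) * oscRight U W x ≤ 2 * (ENNReal.ofReal (S.w x) * localSup V W x) := by
  rw [mul_left_comm]
  exact mul_le_mul_right ((oscRight_mono hU W x).trans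
    (oscRight_le_localSup (mem_of_mem_nhds h.nhds) W x)) _

lemma measurable_weighted_oscRight (U : Set G) :
    Measurable fun x => ENNReal.ofReal (S.w x) * oscRight U W x :=
  S.isControlWeight.continuous.measurable.ennreal_ofReal.mul (measurable_oscRight U h.continuous)

lemma oscMass_ne_top {U : Set G} (hU : U ⊆ V) : S.oscMass W U ≠ ∞ := by
  refine ENNReal.add_ne_top.2 ⟨?_, ?_⟩
  · refine ((lintegral_mono fun x => h.weighted_oscRight_le hU x).trans_lt ?_).ne
    rw [lintegral_const_mul _ h.measurable_weighted]
    exact ENNReal.mul_lt_top (by simp) h.lintegral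
  · refine ((lintegral_mono fun x => h.weighted_oscRight_le hU x⁻¹).trans_lt ?_).ne
    rw [lintegral_const_mul _ h.measurable_weighted_inv]
    exact ENNReal.mul_lt_top (by simp) h.lintegral_inv

/-- Continuity makes the oscillation vanish pointwise along a countable neighbourhood basis, and
twice the local supremum dominates it. -/
lemma exists_oscMass_le {ε : ℝ≥0∞} (hε : 0 < ε) : ∃ U ∈ 𝓝 (1 : G), U ⊆ V ∧ S.oscMass W U ≤ ε := by
  obtain ⟨N, hN⟩ := (𝓝 (1 : G)).exists_antitone_basis
  have hosc (x : G) : Tendsto (fun n => ENNReal.ofReal (S.w x) * oscRight (N n ∩ V) W x) atTop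
      (𝓝 0) := by
    have h1 : Tendsto (fun n => oscRight (N n ∩ V) W x) atTop (𝓝 0) :=
      tendsto_of_tendsto_of_tendsto_of_le_of_le tendsto_const_nhds
        (tendsto_oscRight hN h.continuous x) (fun _ => zero_le)
        fun n => oscRight_mono Set.inter_subset_left W x
    simpa using ENNReal.Tendsto.const_mul h1 (Or.inr ENNReal.ofReal_ne_top)
  have h1 : Tendsto (fun n => ∫⁻ x, ENNReal.ofReal (S.w x) * oscRight (N n ∩ V) W x ∂μ) atTop
      (𝓝 (∫⁻ _, 0 ∂μ)) := by
    refine tendsto_lintegral_of_dominated_convergence _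
      (fun n => h.measurable_weighted_oscRight _)
      (fun n => Eventually.of_forall fun x => h.weighted_oscRight_le Set.inter_subset_right x) ?_
      (Eventually.of_forall hosc)
    rw [lintegral_const_mul _ h.measurable_weighted]
    exact ENNReal.mul_ne_top (by simp) h.lintegral.ne
  have h2 : Tendsto (fun n => ∫⁻ x, ENNReal.ofReal (S.w x⁻¹) * oscRight (N n ∩ V) W x⁻¹ ∂μ) atTop
      (𝓝 (∫⁻ _, 0 ∂μ)) := by
    refine tendsto_lintegral_of_dominated_convergence _
      (fun n => (h.measurable_weighted_oscRight _).comp measurable_inv)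
      (fun n => Eventually.of_forall fun x => h.weighted_oscRight_le Set.inter_subset_right x⁻¹) ?_
      (Eventually.of_forall fun x => hosc x⁻¹)
    rw [lintegral_const_mul _ h.measurable_weighted_inv]
    exact ENNReal.mul_ne_top (by simp) h.lintegral_inv.ne
  have h3 := h1.add h2
  rw [lintegral_zero, add_zero] at h3
  obtain ⟨n, hn⟩ := (h3.eventually_le_const hε).exists
  exact ⟨N n ∩ V, inter_mem (hN.1.mem_of_mem trivial) h.nhds, Set.inter_subset_right, hn⟩

end HasIntegrableMax

/-- Associativity: $f*W=(f*K)*W=f*(K*W)=f*K=f$, at every point. -/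
lemma IsGoodKernel.integral_eq (hW : S.IsGoodKernel W) (h : S.HasIntegrableMax V W) {r : ℝ}
    (hr : 1 < r) {f : G → ℂ} (hf : MemLw μ S.wInv r f) (hfK : conv μ f S.K = f) (x : G) :
    ∫ y, f y * W (y⁻¹ * x) ∂μ = f x := by
  have h1 := S.integral_conv_K_mul hr hf (h.memLw_translate (one_lt_exponent hr) x)
  rw [hfK] at h1
  rw [h1]
  conv_rhs => rw [← hfK]
  have h2 (y : G) : ∫ z, S.K (y⁻¹ * z) * W (z⁻¹ * x) ∂μ = conv μ S.K W (y⁻¹ * x) := by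
    have := integral_mul_left_eq_self (μ := μ) (fun z => S.K z * W (z⁻¹ * (y⁻¹ * x))) y⁻¹
    simpa [conv, mul_assoc] using this
  -- The identity $K*W=K$ is known only a.e., so it is essential that $y\mapsto y^{-1}x$ pulls null
  -- sets back to null sets.
  have hq : Measure.QuasiMeasurePreserving (fun y : G => y⁻¹ * x) μ μ := by
    have h3 := (quasiMeasurePreserving_inv μ).comp
      (measurePreserving_mul_left μ x⁻¹).quasiMeasurePreserving
    simpa [Function.comp_def] using h3
  refine integral_congr_ae ?_
  filter_upwards [hq.ae_eq hW.conv_eq] with y hy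
  rw [h2]
  exact congrArg _ hy

lemma IsGoodKernel.oscRight_le (hW : S.IsGoodKernel W) (h : S.HasIntegrableMax V W) {r : ℝ}
    (hr : 1 < r) {f : G → ℂ} (hf : MemLw μ S.wInv r f) (hfK : conv μ f S.K = f) (U : Set G)
    (x : G) : oscRight U f x ≤ ∫⁻ y, ‖f y‖ₑ * oscRight U W (y⁻¹ * x) ∂μ := by
  refine iSup₂_le fun u hu => ?_
  rw [← hW.integral_eq h hr hf hfK (x * u), ← hW.integral_eq h hr hf hfK x,
    ← integral_sub (h.integrable_mul_translate hr hf _) (h.integrable_mul_translate hr hf _)]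
  refine (enorm_integral_le_lintegral_enorm _).trans (lintegral_mono fun y => ?_)
  rw [← mul_sub, enorm_mul, ← mul_assoc]
  exact mul_le_mul_right (le_iSup₂ (f := fun u (_ : u ∈ U) =>
    ‖W (y⁻¹ * x * u) - W (y⁻¹ * x)‖ₑ) u hu) _

/-- Moderateness, $m(x)\le m(y)\,w(y^{-1}x)$, turns the pointwise bound into an unweighted
convolution of $m|f|$ with $w\,\mathrm{osc}_UW$, to which Young's inequality applies. -/
lemma IsGoodKernel.normLwENN_oscRight_le (hW : S.IsGoodKernel W) (h : S.HasIntegrableMax V W)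
    {r : ℝ} (hr : 1 < r) {m : G → ℝ} (hm : IsModerate S.w m) {f : G → ℂ}
    (hf : MemRKS μ m r S.K f) (U : Set G) :
    normLwENN μ m r (oscRight U f) ≤ S.oscMass W U * normLw μ m r f := by
  have hr0 : 0 < r := by linarith
  have hfi := S.memLw_wInv hm hf.1
  rw [normLw_eq_lintegral hr0, normLwENN, eLpNorm_eq_lintegral_rpow_enorm_toReal
    (by simpa using hr0) ENNReal.ofReal_ne_top, ENNReal.toReal_ofReal hr0.le]
  refine le_trans (ENNReal.rpow_le_rpow (lintegral_mono fun x => ENNReal.rpow_le_rpow ?_ hr0.le)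
    (by positivity)) (lintegral_conv_rpow_le μ hr hf.1.1.enorm (h.measurable_weighted_oscRight U))
  rw [enorm_eq_self]
  refine (mul_le_mul_right (hW.oscRight_le h hr hfi (funext hf.2) U x) _).trans ?_
  rw [← lintegral_const_mul' _ _ ENNReal.ofReal_ne_top]
  refine lintegral_mono fun y => ?_
  have h1 : m x ≤ m y * S.w (y⁻¹ * x) := by simpa using hm.right y (y⁻¹ * x)
  rw [enorm_mul, enorm_coe_of_nonneg (hm.pos y).le]
  calc ENNReal.ofReal (m x) * (‖f y‖ₑ * oscRight U W (y⁻¹ * x))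
      ≤ ENNReal.ofReal (m y) * ENNReal.ofReal (S.w (y⁻¹ * x)) *
          (‖f y‖ₑ * oscRight U W (y⁻¹ * x)) := by
        rw [← ENNReal.ofReal_mul (hm.pos y).le]
        exact mul_le_mul_left (ENNReal.ofReal_le_ofReal h1) _
    _ = _ := by ring

theorem IsGoodKernel.exists_kernelAssumption (hW : S.IsGoodKernel W) {r : ℝ}
    (hr : 1 < r) {m : G → ℝ} (hm : IsModerate S.w m) (hK : RightConvWellDefined μ m r S.K) :
    ∃ (U₀ : Set G) (C : Set G → ℝ≥0), S.KernelAssumption r m U₀ C := by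
  obtain ⟨V, h⟩ := hW.exists_hasIntegrableMax
  -- The truncation to finite values is harmless: the constants are used only for $U\subseteq V$,
  -- where the mass is finite.
  refine ⟨V, fun U => (S.oscMass W U).toNNReal, hr, hm, hK, h.nhds, fun U _ hU f hf => ?_,
    fun ε hε => ?_⟩
  · rw [ENNReal.coe_toNNReal (h.oscMass_ne_top hU)]
    exact hW.normLwENN_oscRight_le h hr hm hf U
  · obtain ⟨U, hU1, hUV, hU⟩ := h.exists_oscMass_le (ε := ε) (by simpa using hε)
    refine ⟨U, hU1, hUV, fun U' _ hU' => ?_⟩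
    exact ENNReal.toNNReal_mono ENNReal.coe_ne_top ((S.oscMass_mono W hU').trans hU)

end Setting

end Coorbit

/-! ### Assembly of the theorem -/

namespace Coorbit.Setting

variable {G : Type*} [TopologicalSpace G] [Group G] [IsTopologicalGroup G] [LocallyCompactSpace G]
  [SecondCountableTopology G] [MeasurableSpace G] [BorelSpace G]
  {μ : Measure G} [μ.IsHaarMeasure]
  {H : Type*} [NormedAddCommGroup H] [InnerProductSpace ℂ H] (S : Setting μ H)

variable {S} in
-- A point $x=x_iu$ is compared with $x_i=xu^{-1}$, so the oscillation runs over $U^{-1}$. This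
-- explains the constant at $U^{-1}$ and the requirement $U\subseteq U_0^{-1}$.
lemma KernelAssumption.neumannHypotheses {r : ℝ} {m : G → ℝ} {U₀ : Set G} {C : Set G → ℝ≥0}
    (hK : S.KernelAssumption r m U₀ C) {U : Set G} (hU : S.DensityCondition r m U₀ C U)
    {I : Type*} {X : I → G} {ψ : I → G → ℝ} (hψ : IsBUPU U X ψ) :
    S.NeumannHypotheses r m U X ψ (C U⁻¹) where
  one_lt := hK.one_lt
  moderate := hK.moderate
  rightConv := hK.rightConv
  compact := hU.compact
  nhds := hU.nhds
  bupu := hψ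
  osc_le := hK.osc_le U⁻¹ (inv_mem_nhds_one G hU.nhds) (Set.inv_subset.2 hU.subset)
  lt_one := hU.lt_one

end Coorbit.Setting

theorem theorem5
    {G : Type*} [TopologicalSpace G] [Group G] [IsTopologicalGroup G] [LocallyCompactSpace G]
    [SecondCountableTopology G] [T2Space G] [MeasurableSpace G] [BorelSpace G]
    (μ : MeasureTheory.Measure G) [μ.IsHaarMeasure]
    {H : Type*} [NormedAddCommGroup H] [InnerProductSpace ℂ H] [CompleteSpace H]
    [TopologicalSpace.SeparableSpace H]
    (S : Coorbit.Setting μ H) :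
    -- Banach frames, with a reconstruction whose action does not depend on `(r, m)`
    (∀ {I : Type*} (X : I → G) (ψ : I → G → ℝ),
      ∃ R : (I → ℂ) → S.Distribution,
        ∀ (r : ℝ) (m : G → ℝ) (U₀ : Set G) (C : Set G → NNReal) (U : Set G),
          S.KernelAssumption r m U₀ C → S.DensityCondition r m U₀ C U →
          Coorbit.IsBUPU U X ψ →
          ∃ Rco : Coorbit.seqSpace (m ∘ X) r →ₗ[ℂ] S.Co r m,
            S.IsBanachFrame r m X Rco ∧
            ∀ c : Coorbit.seqSpace (m ∘ X) r, (Rco c : S.Distribution) = R (c : I → ℂ)) ∧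
    -- the kernel assumption follows from the existence of a well-behaved kernel `W`
    (∀ (r : ℝ) (m : G → ℝ) (W : G → ℂ), 1 < r → Coorbit.IsModerate S.w m →
      Coorbit.RightConvWellDefined μ m r S.K → S.IsGoodKernel W →
      ∃ (U₀ : Set G) (C : Set G → NNReal), S.KernelAssumption r m U₀ C) := by
  -- The operator is fixed before $(r,m)$, $U_0$, $C$ and $U$ are given, which is the asserted
  -- independence.
  refine ⟨fun X ψ => ⟨S.reconstruct X ψ, fun r m U₀ C U hK hU hψ => ?_⟩,
    fun r m W hr hm hK hW => hW.exists_kernelAssumption hr hm hK⟩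
  have h := hK.neumannHypotheses hU hψ
  exact ⟨h.reconstructMap, h.isBanachFrame, fun c => rfl⟩
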